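/- **Setting.** A *tile* in $\mathbb{R}^d$ is a compact connected set equal to the closure of its interior; a *patch* is a collection of tiles with pairwise disjoint interiors, its *support* $\mathrm{supp}$ is the union of its tiles, and a *tiling* is a patch with support $\mathbb{R}^d$. Let $X$ be a translation-invariant set of tilings of $\mathbb{R}^d$ with finite local complexity (up to translation, only finitely many two-tile patches with connected support occur in tilings of $X$) and complete for the tiling metric $$d_T(x,y)=\inf\Big(\{\tfrac{\sqrt2}{2}\}\cup\{0<r<\tfrac{\sqrt2}{2}:\ \text{there are } p\subset x,\ q\subset y \text{ with bounded supports containing } B_{1/r} \text{ and } \|\vec t\|\le r \text{ with } \vec t+p=q\}\Big),$$ where $B_s$ is the closed ball of radius $s$ centred at $0$. Write $\mathcal P^1(X)$ for the set of tiles, and $\mathcal P(X)$ for the set of nonempty finite patches, contained in tilings of $X$ (and similarly for subsets of $X$). Let $D_1,\dots,D_l\in\mathcal P^1(X)$ represent, without repetition, all tiles of $X$ up to translation. A *substitution* is a map $S:\mathcal P^1(X)\to\mathcal P(X)$ for which there is $\lambda>1$ with $\mathrm{supp}(S(P))=\lambda P$ and $S(\vec t+P)=\lambda\vec t+S(P)$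 for all $P\in\mathcal P^1(X)$ and $\vec t\in\mathbb R^d$, and whose extension $S(x)=\bigcup_{D\in x}S(D)$ maps $\mathcal P(X)$ into $\mathcal P(X)$ and $X$ into $X$. Its structure matrix has as $(i,j)$ entry the number of translates of $D_i$ in $S(D_j)$. Let $\mathcal S=\{S_i\}_{i\in J}$ be a finite family of substitutions, with structure matrices $A_i$, that is *primitive*: for every $\bar b\in\Sigma=J^{\mathbb N}$ and every $n$ there is $N\ge 0$ with $A_{b_n}A_{b_{n+1}}\cdots A_{b_{n+N}}>0$ entrywise. Equip $\Sigma$ with $d_\Sigma(\bar a,\bar b)=1/L$, where $L$ is the first index with $a_L\ne b_L$ (and $d_\Sigma(\bar a,\bar a)=0$). Fix $D\in\mathcal P^1(X)$, and for $\bar b\in\Sigma$ put $S_{\bar b}^k=S_{b_1}\circ\cdots\circ S_{b_k}$, $x_{\bar b}^1=D$ and $x_{\bar b}^k=S_{\bar b}^k(D)$ for $k>1$. Let $X_{\bar b}$ be the set of $x\in X$ each of whose finite patches has a translate contained in some $x_{\bar b}^k$, $k>0$. Let $x_{\bar b}^\infty$ be a tiling of the form $\bigcup_n x'_n$, where $x'_n=\vec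 t_n+S_{\bar b}^{k_n}(D)$ with $k_n>0$, $x'_{n-1}\subset x'_n$ and $\mathrm{supp}(x'_{n-1})\subset B_{r_n}\subset\mathrm{supp}(x'_n)$ for some $r_n\to\infty$. For a nonempty finite patch $x'$ and $H\subset\mathbb R^d$, let $L^{\bar b}_{x'}(H)$ be the number of distinct translates of $x'$ that are contained in $x_{\bar b}^\infty$ and have support contained in $H$. A sequence $(H_n)$ of subsets of $\mathbb R^d$ with $0<\mathrm{vol}(H_n)<\infty$ is a *Van Hove sequence* if $\mathrm{vol}(\{\vec t:\mathrm{dist}(\vec t,\partial H_n)\le r\})/\mathrm{vol}(H_n)\to0$ for every $r\ge0$. A number $f>0$ is the *frequency* $\mathrm{freq}_{\bar b}(x')$ if $L^{\bar b}_{x'}(H_n)/\mathrm{vol}(H_n)\to f$ for every Van Hove sequence $(H_n)$. **Theorem.** Let $\bar a\in\Sigma$ and $x'\in\mathcal P(X_{\bar a})$. There is $\delta>0$ such that for every $\bar b\in\Sigma$ with $d_\Sigma(\bar a,\bar b)<\delta$ the patch $x'$ belongs to $\mathcal P(X_{\bar b})$, a tiling $x^\infty_{\bar b}$ as above exists, and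 the frequency $\mathrm{freq}_{\bar b}(x')>0$ exists; and such that, for every Van Hove sequence $(H_n)$, $$\frac{L^{\bar b}_{x'}(H_n)}{\mathrm{vol}(H_n)}\longrightarrow \mathrm{freq}_{\bar b}(x')\qquad\text{as } n\to\infty,$$ uniformly in $\bar b\in\Sigma$ with $d_\Sigma(\bar a,\bar b)<\delta$. -/

import Mathlib

open Filter Topology MeasureTheory
open scoped Pointwise

noncomputable section

namespace MultiTiling

/-- Euclidean space of dimension `d`, with its Euclidean norm. -/
abbrev Euc (d : ℕ) := EuclideanSpace ℝ (Fin d)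

/-- Collections of subsets of Euclidean space. Since tiles have nonempty interior, a patch
(a collection of tiles with pairwise disjoint interiors) is the same as such a set of tiles. -/
abbrev Coll (d : ℕ) := Set (Set (Euc d))

variable {d : ℕ}

/-- A tile: compact, connected, equal to the closure of its interior. -/
structure IsTile (D : Set (Euc d)) : Prop where
  isCompact : IsCompact D
  isConnected : IsConnected D
  closure_interior : closure (interior D) = D

/-- The support of a collection of tiles. -/
def supp (x : Coll d) : Set (Euc d) := ⋃₀ x

/-- A patch: a collection of tiles with pairwise disjoint interiors. -/
structure IsPatch (x : Coll d) : Prop where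
  isTile : ∀ D ∈ x, IsTile D
  disjoint : ∀ D ∈ x, ∀ D' ∈ x, D ≠ D' → interior D ∩ interior D' = ∅

/-- A tiling: a patch whose support is the whole space. -/
structure IsTiling (x : Coll d) : Prop where
  isPatch : IsPatch x
  supp_eq : supp x = Set.univ

/-- `𝒫(X)`: the finite nonempty patches contained in some tiling of `X`. -/
def patches (X : Set (Coll d)) : Set (Coll d) :=
  {p | p.Finite ∧ p.Nonempty ∧ ∃ x ∈ X, p ⊆ x}

/-- `𝒫¹(X)`: the tiles that occur in some tiling of `X`. -/
def tiles (X : Set (Coll d)) : Set (Set (Euc d)) := {D | ∃ x ∈ X, D ∈ x}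

/-- A translation invariant set of tilings. -/
structure IsTilingSpace (X : Set (Coll d)) : Prop where
  isTiling : ∀ x ∈ X, IsTiling x
  vadd_mem : ∀ (t : Euc d), ∀ x ∈ X, t +ᵥ x ∈ X

/-- Finite local complexity: up to translation, there are only finitely many two-tile patches
with connected support in the tilings of `X`. -/
def FiniteLocalComplexity (X : Set (Coll d)) : Prop :=
  ∃ F : Set (Coll d), F.Finite ∧
    ∀ p ∈ patches X, p.ncard = 2 → IsConnected (supp p) → ∃ q ∈ F, ∃ t : Euc d, p = t +ᵥ q

/-- `x[[K]]`: the patches of bounded support contained in `x` whose support covers `K`. -/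
def coveringPatches (x : Coll d) (K : Set (Euc d)) : Set (Coll d) :=
  {p | p ⊆ x ∧ Bornology.IsBounded (supp p) ∧ K ⊆ supp p}

/-- The tiling metric `d_T`. -/
def tilingDist (x y : Coll d) : ℝ :=
  sInf ({√2 / 2} ∪ {r : ℝ | 0 < r ∧ r < √2 / 2 ∧
    ∃ p ∈ coveringPatches x (Metric.closedBall 0 (1 / r)),
    ∃ q ∈ coveringPatches y (Metric.closedBall 0 (1 / r)),
    ∃ t : Euc d, ‖t‖ ≤ r ∧ t +ᵥ p = q})

/-- `X` is complete for the tiling metric. -/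
def IsCompleteTilingSpace (X : Set (Coll d)) : Prop :=
  ∀ u : ℕ → Coll d, (∀ n, u n ∈ X) →
    (∀ ε > 0, ∃ N, ∀ m ≥ N, ∀ n ≥ N, tilingDist (u m) (u n) < ε) →
    ∃ x ∈ X, Tendsto (fun n => tilingDist (u n) x) atTop (𝓝 0)

/-- The extension of a map on tiles to collections of tiles. -/
def substColl (S : Set (Euc d) → Coll d) (x : Coll d) : Coll d := ⋃ D ∈ x, S D

/-- `S`, restricted to the tiles of `X`, is a (self-similar) substitution `𝒫¹(X) → 𝒫(X)` that
extends to maps `𝒫(X) → 𝒫(X)` and `X → X`. Its values on other sets are irrelevant. -/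
def IsSubstitution (X : Set (Coll d)) (S : Set (Euc d) → Coll d) : Prop :=
  (∀ D ∈ tiles X, S D ∈ patches X) ∧
  (∃ lam : ℝ, 1 < lam ∧
    (∀ D ∈ tiles X, supp (S D) = lam • D) ∧
    (∀ D ∈ tiles X, ∀ t : Euc d, S (t +ᵥ D) = (lam • t) +ᵥ S D)) ∧
  (∀ p ∈ patches X, substColl S p ∈ patches X) ∧
  (∀ x ∈ X, substColl S x ∈ X)

/-- `D 0, …, D (l-1)` are pairwise inequivalent and represent all tiles of `X` up to
translation. -/
structure IsPrototileSystem (X : Set (Coll d)) {l : ℕ} (D : Fin l → Set (Euc d)) : Prop where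
  mem : ∀ i, D i ∈ tiles X
  exists_eq : ∀ P ∈ tiles X, ∃ i, ∃ t : Euc d, P = t +ᵥ D i
  inequivalent : ∀ i j, ∀ t : Euc d, D i = t +ᵥ D j → i = j

/-- The structure matrix: entry `(i, j)` is the number of translates of `D i` in `S (D j)`. -/
def structureMatrix {l : ℕ} (D : Fin l → Set (Euc d)) (S : Set (Euc d) → Coll d) :
    Matrix (Fin l) (Fin l) ℕ :=
  Matrix.of fun i j => {P | P ∈ S (D j) ∧ ∃ t : Euc d, P = t +ᵥ D i}.ncard

variable {J : Type*}

/-- The sequence of substitutions `S_{a_0}, S_{a_1}, …` is primitive: for each `n` there is `N`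
such that the matrix `A_{a_n} A_{a_{n+1}} ⋯ A_{a_{n+N}}` has only positive entries. -/
def IsPrimitiveSeq {l : ℕ} (D : Fin l → Set (Euc d)) (S : J → Set (Euc d) → Coll d)
    (a : ℕ → J) : Prop :=
  ∀ n, ∃ N, ∀ i j,
    0 < ((List.range (N + 1)).map fun m => structureMatrix D (S (a (n + m)))).prod i j

/-- `S_a^k = S_{a_0} ∘ ⋯ ∘ S_{a_{k-1}}`, acting on collections of tiles. -/
def iterSubst (S : J → Set (Euc d) → Coll d) : (ℕ → J) → ℕ → Coll d → Coll d
  | _, 0, x => x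
  | a, k + 1, x => substColl (S (a 0)) (iterSubst S (fun n => a (n + 1)) k x)

/-- The patches `x_a^1 = D₀` and `x_a^k = S_a^k(D₀)` for `k > 1`. -/
def levelPatch (S : J → Set (Euc d) → Coll d) (D₀ : Set (Euc d)) (a : ℕ → J) (k : ℕ) : Coll d :=
  if k = 1 then {D₀} else iterSubst S a k {D₀}

/-- The multi-substitution tiling space `X_a`, defined from the initial tile `D₀`. -/
def multiSubstSpace (X : Set (Coll d)) (S : J → Set (Euc d) → Coll d) (D₀ : Set (Euc d))
    (a : ℕ → J) : Set (Coll d) :=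
  {x | x ∈ X ∧ ∀ p ⊆ x, p.Finite → ∃ k > 0, ∃ t : Euc d, t +ᵥ p ⊆ levelPatch S D₀ a k}

/-- `y` is the union of an increasing sequence of patches `x'_n = t_n + S_a^{k_n}(D₀)` with
`supp x'_{n-1} ⊆ B_{r_n} ⊆ supp x'_n` and `r_n → ∞`. -/
def IsLimitTiling (S : J → Set (Euc d) → Coll d) (D₀ : Set (Euc d)) (a : ℕ → J)
    (y : Coll d) : Prop :=
  ∃ (t : ℕ → Euc d) (k : ℕ → ℕ) (r : ℕ → ℝ),
    (∀ n, 0 < k n) ∧ Tendsto r atTop atTop ∧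
    (∀ n, t n +ᵥ iterSubst S a (k n) {D₀} ⊆ t (n + 1) +ᵥ iterSubst S a (k (n + 1)) {D₀}) ∧
    (∀ n, supp (t n +ᵥ iterSubst S a (k n) {D₀}) ⊆ Metric.closedBall 0 (r (n + 1))) ∧
    (∀ n, Metric.closedBall 0 (r n) ⊆ supp (t n +ᵥ iterSubst S a (k n) {D₀})) ∧
    y = ⋃ n, t n +ᵥ iterSubst S a (k n) {D₀}

/-- The tiling `x_a^∞`: some tiling obtained by the construction of `IsLimitTiling`. Nothing is
known about it unless such a tiling is shown to exist. -/
def limitTiling (S : J → Set (Euc d) → Coll d) (D₀ : Set (Euc d)) (a : ℕ → J) : Coll d :=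
  Classical.epsilon (IsLimitTiling S D₀ a)

/-- `L^a_{x'}(H)`: the number of distinct translates of `x'` in `x_a^∞` with support
contained in `H`. -/
def patchCount (S : J → Set (Euc d) → Coll d) (D₀ : Set (Euc d)) (a : ℕ → J) (x' : Coll d)
    (H : Set (Euc d)) : ℕ :=
  {q : Coll d | (∃ t : Euc d, q = t +ᵥ x') ∧ q ⊆ limitTiling S D₀ a ∧ supp q ⊆ H}.ncard

/-- A Van Hove sequence of sets of finite positive volume. The quotient is taken in
`[0, ∞]`, and `Metric.cthickening r A` is the set of points at distance at most `r` from `A`. -/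
structure IsVanHove (H : ℕ → Set (Euc d)) : Prop where
  volume_pos : ∀ n, 0 < volume (H n)
  volume_lt_top : ∀ n, volume (H n) < ⊤
  tendsto : ∀ r : ℝ, 0 ≤ r →
    Tendsto (fun n => volume (Metric.cthickening r (frontier (H n))) / volume (H n)) atTop (𝓝 0)

/-- `f` is the frequency of `x'` for `a`: a positive number that is the limit of
`L^a_{x'}(H_n) / vol(H_n)` for every Van Hove sequence `(H_n)`. -/
def IsPatchFreq (S : J → Set (Euc d) → Coll d) (D₀ : Set (Euc d)) (a : ℕ → J) (x' : Coll d)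
    (f : ℝ) : Prop :=
  0 < f ∧ ∀ H : ℕ → Set (Euc d), IsVanHove H →
    Tendsto (fun n => (patchCount S D₀ a x' (H n) : ℝ) / (volume (H n)).toReal) atTop (𝓝 f)

/-- The frequency `freq_a(x')`, meaningful once `IsPatchFreq` is shown to hold for some number
(which is then unique). -/
def patchFreq (S : J → Set (Euc d) → Coll d) (D₀ : Set (Euc d)) (a : ℕ → J) (x' : Coll d) : ℝ :=
  Classical.epsilon (IsPatchFreq S D₀ a x')

open Classical in
/-- The metric on sequences: `1 / L`, with `L` the first place (counted from `1`) where the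
sequences differ. `PiNat.firstDiff` counts from `0`. -/
def seqDist (a b : ℕ → J) : ℝ :=
  if a = b then 0 else 1 / ((PiNat.firstDiff a b : ℝ) + 1)

end MultiTiling

end

namespace MultiTiling

section

variable {d : ℕ}

/-! ### Tiles and patches -/

/-! Cut a tiling into supertiles of level `m`, the translates of the patches `S_b^m(Q)` with `Q` a
tile. A copy of `x'` either lies inside one supertile or crosses a boundary between supertiles, and
crossings are negligible for large `m`. The frequency is therefore the common limit of the densities
of copies of `x'` in supertiles, and every estimate has constants independent of `b`.

Crossings: a crossing copy has its marked tile `P₀` in a collar of bounded width around the boundary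
of a supertile. After rescaling, the collar shrinks to the boundary of a tile, which is a null set
(`IsSubstSystem.volume_frontier`), so a packing argument bounds the number of crossings by `η m`
times the volume, with `η m → 0` (`IsSubstSystem.exists_crossings_bound`).

Convergence: since `S_b^(m+k) = S_b^m ∘ S_(tail b m)^k`, a supertile of level `m + k` is a union of
supertiles of level `m`. Hence the least density over prototiles does not decrease with the level,
while the greatest increases by at most `η m`. Compactness of `J^ℕ` makes primitivity uniform: after
`K` steps every tile contains every prototile, with a volume share at least `c`. The gap between
greatest and least density thus contracts by the factor `1 - c`, up to `η m`
(`IsSubstSystem.exists_density_limit`).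

Windows: in a limit tiling, the supertiles of level `m` that meet both `H` and its complement lie in
a collar of the boundary of `H`, whose relative volume vanishes along a Van Hove sequence. This
gives convergence uniform over all of `J^ℕ` (`IsSubstSystem.exists_uniform_frequency`).

The number `δ` matters only for the occurrence of `x'` and for positivity. A copy of `x'` lies in
some `S_a^k(D₀)`, which depends on only `k` letters. If `b` shares them, uniform primitivity puts a
copy of `x'` in every supertile of one fixed level. -/

theorem IsTile.interior_nonempty {P : Set (Euc d)} (hP : IsTile P) : (interior P).Nonempty := by
  by_contra h
  have h0 := hP.closure_interior
  rw [Set.not_nonempty_iff_eq_empty.1 h, closure_empty] at h0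
  exact hP.isConnected.nonempty.ne_empty h0.symm

theorem IsTile.nonempty {P : Set (Euc d)} (hP : IsTile P) : P.Nonempty := hP.isConnected.nonempty

theorem IsTile.inter_interior_nonempty {P U : Set (Euc d)} (hP : IsTile P) (hU : IsOpen U)
    (h : (U ∩ P).Nonempty) : (U ∩ interior P).Nonempty := by
  obtain ⟨x, hxU, hxP⟩ := h
  rw [← hP.closure_interior] at hxP
  exact mem_closure_iff.1 hxP U hU hxU

theorem IsPatch.mono {x y : Coll d} (hy : IsPatch y) (h : x ⊆ y) : IsPatch x :=
  ⟨fun P hP => hy.isTile P (h hP), fun P hP Q hQ => hy.disjoint P (h hP) Q (h hQ)⟩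

theorem IsPatch.eq_of_interior_inter {x : Coll d} (hx : IsPatch x) {P Q : Set (Euc d)}
    (hP : P ∈ x) (hQ : Q ∈ x) (h : (interior P ∩ Q).Nonempty) : P = Q := by
  by_contra hne
  have := (hx.isTile Q hQ).inter_interior_nonempty isOpen_interior h
  rw [hx.disjoint P hP Q hQ hne] at this
  exact Set.not_nonempty_empty this

/-- A tile of a patch that is covered by a subpatch belongs to the subpatch. -/
theorem IsPatch.mem_of_subset_supp {x p : Coll d} (hx : IsPatch x) (hp : p ⊆ x)
    {P : Set (Euc d)} (hP : P ∈ x) (h : P ⊆ supp p) : P ∈ p := by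
  obtain ⟨z, hz⟩ := (hx.isTile P hP).interior_nonempty
  obtain ⟨Q, hQ, hzQ⟩ := h (interior_subset hz)
  rwa [hx.eq_of_interior_inter hP (hp hQ) ⟨z, hz, hzQ⟩]

theorem eq_zero_of_vadd_eq_self {P : Set (Euc d)} (hc : IsCompact P) (hn : P.Nonempty)
    {u : Euc d} (h : u +ᵥ P = P) : u = 0 := by
  -- Translation by `u` raises the linear functional `⟨u, ·⟩` by `‖u‖ ^ 2`, which is impossible at a
  -- maximum over `P` unless `u = 0`.
  obtain ⟨x, hx, hmax⟩ := hc.exists_isMaxOn hn (f := fun z => inner ℝ u z) (by fun_prop)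
  have h1 : u +ᵥ x ∈ P := by rw [← h]; exact Set.vadd_mem_vadd_set hx
  have h2 := hmax h1
  simp only [Set.mem_ofPred_eq, vadd_eq_add, inner_add_right] at h2
  have h3 : inner ℝ u u ≤ (0 : ℝ) := by linarith
  rw [real_inner_self_eq_norm_sq] at h3
  exact norm_eq_zero.1 (pow_eq_zero_iff two_ne_zero |>.1 (le_antisymm h3 (sq_nonneg _)))

theorem vadd_set_injective {P : Set (Euc d)} (hc : IsCompact P) (hn : P.Nonempty) :
    Function.Injective fun t : Euc d => t +ᵥ P := by
  intro t s h
  have h' : t +ᵥ P = s +ᵥ P := h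
  have : (-s + t) +ᵥ P = P := by rw [add_vadd, h', ← add_vadd]; simp
  have := eq_zero_of_vadd_eq_self hc hn this
  rw [neg_add_eq_zero] at this
  exact this.symm

theorem IsTile.vadd_injective {P : Set (Euc d)} (hP : IsTile P) :
    Function.Injective fun t : Euc d => t +ᵥ P := vadd_set_injective hP.isCompact hP.nonempty

theorem supp_vadd (t : Euc d) (x : Coll d) : supp (t +ᵥ x) = t +ᵥ supp x := by
  ext z
  simp only [supp, Set.mem_sUnion, Set.mem_vadd_set_iff_neg_vadd_mem]
  constructor
  · rintro ⟨P, hP, hz⟩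
    exact ⟨-t +ᵥ P, hP, Set.vadd_mem_vadd_set hz⟩
  · rintro ⟨P, hP, hz⟩
    exact ⟨t +ᵥ P, by simpa using hP, Set.mem_vadd_set_iff_neg_vadd_mem.2 hz⟩

theorem supp_mono {x y : Coll d} (h : x ⊆ y) : supp x ⊆ supp y := Set.sUnion_subset_sUnion h

theorem subset_supp {x : Coll d} {P : Set (Euc d)} (h : P ∈ x) : P ⊆ supp x :=
  Set.subset_sUnion_of_mem h

@[simp] theorem supp_singleton (P : Set (Euc d)) : supp {P} = P := Set.sUnion_singleton P

section TilingSpace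

variable {X : Set (Coll d)} (hX : IsTilingSpace X)
include hX

theorem IsTilingSpace.isPatch_of_subset {p x : Coll d} (hx : x ∈ X) (h : p ⊆ x) : IsPatch p :=
  (hX.isTiling x hx).isPatch.mono h

theorem IsTilingSpace.isPatch {p : Coll d} (hp : p ∈ patches X) : IsPatch p := by
  obtain ⟨-, -, x, hx, h⟩ := hp
  exact hX.isPatch_of_subset hx h

theorem IsTilingSpace.isTile {P : Set (Euc d)} (hP : P ∈ tiles X) : IsTile P := by
  obtain ⟨x, hx, h⟩ := hP
  exact (hX.isTiling x hx).isPatch.isTile P h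

theorem IsTilingSpace.vadd_mem_patches {p : Coll d} (hp : p ∈ patches X) (t : Euc d) :
    t +ᵥ p ∈ patches X := by
  obtain ⟨h1, h2, x, hx, h⟩ := hp
  exact ⟨h1.vadd_set, h2.vadd_set, t +ᵥ x, hX.vadd_mem t x hx, Set.vadd_set_mono h⟩

end TilingSpace

theorem singleton_mem_patches {X : Set (Coll d)} {P : Set (Euc d)} (hP : P ∈ tiles X) :
    {P} ∈ patches X := by
  obtain ⟨x, hx, h⟩ := hP
  exact ⟨Set.finite_singleton P, Set.singleton_nonempty P, x, hx, Set.singleton_subset_iff.2 h⟩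

theorem subset_tiles_of_mem_patches {X : Set (Coll d)} {p : Coll d} (hp : p ∈ patches X) :
    p ⊆ tiles X := by
  obtain ⟨-, -, x, hx, h⟩ := hp
  exact fun P hP => ⟨x, hx, h hP⟩

/-! ### Compositions of substitutions -/

variable {J : Type*}

/-- The sequence `b` with its first `n` terms removed. -/
def tail (b : ℕ → J) (n : ℕ) : ℕ → J := fun i => b (n + i)

/-- The inflation factor of `S_b^n`. -/
def scale (lam : J → ℝ) (b : ℕ → J) (n : ℕ) : ℝ := ∏ i ∈ Finset.range n, lam (b i)

@[simp] theorem scale_zero (lam : J → ℝ) (b : ℕ → J) : scale lam b 0 = 1 := by simp [scale]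

theorem scale_add (lam : J → ℝ) (b : ℕ → J) (n k : ℕ) :
    scale lam b (n + k) = scale lam b n * scale lam (tail b n) k := by
  simp [scale, tail, Finset.prod_range_add]

theorem scale_succ (lam : J → ℝ) (b : ℕ → J) (n : ℕ) :
    scale lam b (n + 1) = lam (b 0) * scale lam (tail b 1) n := by
  rw [add_comm, scale_add]; simp [scale]

theorem tail_succ_eq (b : ℕ → J) : (fun n => b (n + 1)) = tail b 1 := by
  funext n; simp [tail, add_comm]

@[simp] theorem tail_zero (b : ℕ → J) : tail b 0 = b := by funext n; simp [tail]

theorem tail_tail (b : ℕ → J) (n k : ℕ) : tail (tail b n) k = tail b (n + k) := by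
  funext i; simp [tail, add_assoc]

variable (S : J → Set (Euc d) → Coll d)

@[simp] theorem iterSubst_zero (b : ℕ → J) (x : Coll d) : iterSubst S b 0 x = x := rfl

theorem iterSubst_succ (b : ℕ → J) (n : ℕ) (x : Coll d) :
    iterSubst S b (n + 1) x = substColl (S (b 0)) (iterSubst S (tail b 1) n x) := by
  rw [iterSubst, tail_succ_eq]

/-- The first letter acts last. A patch of level `n + k` is thus a union of level-`n` supertiles
built with the first `n` letters, placed along a patch generated by the remaining letters. -/
theorem iterSubst_add (b : ℕ → J) (n k : ℕ) (x : Coll d) :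
    iterSubst S b (n + k) x = iterSubst S b n (iterSubst S (tail b n) k x) := by
  induction n generalizing b with
  | zero => simp
  | succ n ih =>
    rw [show n + 1 + k = (n + k) + 1 by ring, iterSubst_succ, ih, iterSubst_succ, tail_tail,
      add_comm 1 n]

theorem iterSubst_congr {b c : ℕ → J} {n : ℕ} (h : ∀ i < n, b i = c i) (x : Coll d) :
    iterSubst S b n x = iterSubst S c n x := by
  induction n generalizing b c with
  | zero => simp
  | succ n ih =>
    have h1 : ∀ i < n, tail b 1 i = tail c 1 i := fun i hi => h (1 + i) (by omega)
    rw [iterSubst_succ, iterSubst_succ, h 0 (by omega), ih h1]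

theorem mem_substColl {s : Set (Euc d) → Coll d} {x : Coll d} {P : Set (Euc d)} :
    P ∈ substColl s x ↔ ∃ Q ∈ x, P ∈ s Q := by simp [substColl]

theorem mem_iterSubst (b : ℕ → J) (n : ℕ) (x : Coll d) {P : Set (Euc d)} :
    P ∈ iterSubst S b n x ↔ ∃ Q ∈ x, P ∈ iterSubst S b n {Q} := by
  induction n generalizing b P with
  | zero => simp
  | succ n ih =>
    simp only [iterSubst_succ, mem_substColl]
    constructor
    · rintro ⟨R, hR, hP⟩
      obtain ⟨Q, hQ, hRQ⟩ := (ih _).1 hR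
      exact ⟨Q, hQ, R, hRQ, hP⟩
    · rintro ⟨Q, hQ, R, hRQ, hP⟩
      exact ⟨R, (ih _).2 ⟨Q, hQ, hRQ⟩, hP⟩

theorem iterSubst_mono (b : ℕ → J) (n : ℕ) {x y : Coll d} (h : x ⊆ y) :
    iterSubst S b n x ⊆ iterSubst S b n y := by
  intro P hP
  rw [mem_iterSubst] at hP ⊢
  obtain ⟨Q, hQ, h'⟩ := hP
  exact ⟨Q, h hQ, h'⟩

/-- A family of substitutions of `X` with inflation factors `lam j`. -/
structure IsSubstSystem (X : Set (Coll d)) (S : J → Set (Euc d) → Coll d) (lam : J → ℝ) :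
    Prop where
  isTilingSpace : IsTilingSpace X
  one_lt : ∀ j, 1 < lam j
  supp_eq : ∀ j, ∀ P ∈ tiles X, supp (S j P) = lam j • P
  map_vadd : ∀ j, ∀ P ∈ tiles X, ∀ t : Euc d, S j (t +ᵥ P) = (lam j • t) +ᵥ S j P
  map_patches : ∀ j, ∀ p ∈ patches X, substColl (S j) p ∈ patches X

variable {S} {X : Set (Coll d)} {lam : J → ℝ} (h : IsSubstSystem X S lam)
include h

theorem IsSubstSystem.scale_pos (b : ℕ → J) (n : ℕ) : 0 < scale lam b n :=
  Finset.prod_pos fun _ _ => one_pos.trans (h.one_lt _)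

theorem IsSubstSystem.iterSubst_mem_patches (b : ℕ → J) (n : ℕ) {p : Coll d}
    (hp : p ∈ patches X) : iterSubst S b n p ∈ patches X := by
  induction n generalizing b with
  | zero => simpa
  | succ n ih => rw [iterSubst_succ]; exact h.map_patches _ _ (ih _)

theorem IsSubstSystem.mem_tiles_of_mem {b : ℕ → J} {n : ℕ} {x : Coll d} (hx : x ⊆ tiles X)
    {P : Set (Euc d)} (hP : P ∈ iterSubst S b n x) : P ∈ tiles X := by
  obtain ⟨Q, hQ, hP⟩ := (mem_iterSubst S b n x).1 hP
  exact subset_tiles_of_mem_patches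
    (h.iterSubst_mem_patches b n (singleton_mem_patches (hx hQ))) hP

theorem IsSubstSystem.substColl_vadd (j : J) {x : Coll d} (hx : x ⊆ tiles X) (t : Euc d) :
    substColl (S j) (t +ᵥ x) = (lam j • t) +ᵥ substColl (S j) x := by
  ext P
  rw [Set.mem_vadd_set_iff_neg_vadd_mem, mem_substColl, mem_substColl]
  constructor
  · rintro ⟨Q, ⟨R, hR, rfl⟩, hP⟩
    refine ⟨R, hR, ?_⟩
    simp only [h.map_vadd j R (hx hR)] at hP
    rwa [← Set.mem_vadd_set_iff_neg_vadd_mem]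
  · rintro ⟨Q, hQ, hP⟩
    refine ⟨t +ᵥ Q, Set.vadd_mem_vadd_set hQ, ?_⟩
    rw [h.map_vadd j Q (hx hQ)]
    rwa [Set.mem_vadd_set_iff_neg_vadd_mem]

theorem IsSubstSystem.iterSubst_vadd (b : ℕ → J) (n : ℕ) {x : Coll d} (hx : x ⊆ tiles X)
    (t : Euc d) : iterSubst S b n (t +ᵥ x) = (scale lam b n • t) +ᵥ iterSubst S b n x := by
  induction n generalizing b with
  | zero => simp
  | succ n ih =>
    rw [iterSubst_succ, ih, h.substColl_vadd _ (fun P hP => h.mem_tiles_of_mem hx hP),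
      iterSubst_succ, scale_succ, mul_smul]

theorem IsSubstSystem.iterSubst_singleton_vadd (b : ℕ → J) (n : ℕ) {P : Set (Euc d)}
    (hP : P ∈ tiles X) (t : Euc d) :
    iterSubst S b n {t +ᵥ P} = (scale lam b n • t) +ᵥ iterSubst S b n {P} := by
  rw [← h.iterSubst_vadd b n (Set.singleton_subset_iff.2 hP), Set.vadd_set_singleton]

theorem IsSubstSystem.supp_substColl (j : J) {x : Coll d} (hx : x ⊆ tiles X) :
    supp (substColl (S j) x) = lam j • supp x := by
  have h1 : supp (substColl (S j) x) = ⋃ P ∈ x, supp (S j P) := by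
    ext z; simp only [supp, substColl, Set.mem_sUnion, Set.mem_iUnion]; tauto
  rw [h1, supp, Set.sUnion_eq_biUnion, Set.smul_set_iUnion₂]
  exact Set.iUnion₂_congr fun P hP => h.supp_eq j P (hx hP)

theorem IsSubstSystem.supp_iterSubst (b : ℕ → J) (n : ℕ) {x : Coll d} (hx : x ⊆ tiles X) :
    supp (iterSubst S b n x) = scale lam b n • supp x := by
  induction n generalizing b with
  | zero => simp
  | succ n ih =>
    rw [iterSubst_succ, h.supp_substColl _ (fun P hP => h.mem_tiles_of_mem hx hP), ih,
      scale_succ, mul_smul]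

theorem IsSubstSystem.supp_iterSubst_singleton (b : ℕ → J) (n : ℕ) {P : Set (Euc d)}
    (hP : P ∈ tiles X) : supp (iterSubst S b n {P}) = scale lam b n • P := by
  rw [h.supp_iterSubst b n (Set.singleton_subset_iff.2 hP), supp_singleton]

theorem IsSubstSystem.subset_smul_of_mem {b : ℕ → J} {n : ℕ} {P R : Set (Euc d)}
    (hP : P ∈ tiles X) (hR : R ∈ iterSubst S b n {P}) : R ⊆ scale lam b n • P := by
  rw [← h.supp_iterSubst_singleton b n hP]; exact subset_supp hR

/-- The images of different tiles of a patch have no tile in common. -/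
theorem IsSubstSystem.eq_of_mem_iterSubst {b : ℕ → J} {n : ℕ} {p : Coll d} (hp : p ∈ patches X)
    {P Q R : Set (Euc d)} (hP : P ∈ p) (hQ : Q ∈ p)
    (hRP : R ∈ iterSubst S b n {P}) (hRQ : R ∈ iterSubst S b n {Q}) : P = Q := by
  have hPt := subset_tiles_of_mem_patches hp hP
  have hQt := subset_tiles_of_mem_patches hp hQ
  have hs := (h.scale_pos b n).ne'
  have hR : R ∈ tiles X := h.mem_tiles_of_mem (Set.singleton_subset_iff.2 hPt) hRP
  by_contra hne
  obtain ⟨z, hz⟩ := (h.isTilingSpace.isTile hR).interior_nonempty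
  have h1 := interior_mono (h.subset_smul_of_mem hPt hRP) hz
  have h2 := interior_mono (h.subset_smul_of_mem hQt hRQ) hz
  rw [interior_smul₀ hs, Set.mem_smul_set_iff_inv_smul_mem₀ hs] at h1 h2
  have := (h.isTilingSpace.isPatch hp).disjoint P hP Q hQ hne
  exact Set.notMem_empty _ (this.subset ⟨h1, h2⟩)

/-- A tile in the image of one tile of a patch is not contained in the support of the image of
another one. -/
theorem IsSubstSystem.not_subset_smul_of_mem {b : ℕ → J} {n : ℕ} {p : Coll d}
    (hp : p ∈ patches X) {P R : Set (Euc d)} (hP : P ∈ p)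
    (hR : R ∈ iterSubst S b n p) (hRP : R ∉ iterSubst S b n {P}) :
    ¬ R ⊆ scale lam b n • P := by
  intro hsub
  rw [← h.supp_iterSubst_singleton b n (subset_tiles_of_mem_patches hp hP)] at hsub
  exact hRP ((h.isTilingSpace.isPatch (h.iterSubst_mem_patches b n hp)).mem_of_subset_supp
    (iterSubst_mono S b n (Set.singleton_subset_iff.2 hP)) hR hsub)

end

section

variable {d : ℕ}

/-! ### Uniform bounds -/

theorem exists_pos_forall_le {ι : Type*} [Finite ι] (f : ι → ℝ) (hf : ∀ i, 0 < f i) :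
    ∃ ε > 0, ∀ i, ε ≤ f i := by
  cases isEmpty_or_nonempty ι with
  | inl _ => exact ⟨1, one_pos, fun i => isEmptyElim i⟩
  | inr _ =>
    obtain ⟨i, hi⟩ := Finite.exists_min f
    exact ⟨f i, hf i, hi⟩

theorem exists_pos_forall_ge {ι : Type*} [Finite ι] (f : ι → ℝ) : ∃ C > 0, ∀ i, f i ≤ C := by
  obtain ⟨C, hC⟩ := (Set.finite_range f).bddAbove
  exact ⟨max C 1, lt_max_of_lt_right one_pos,
    fun i => (hC (Set.mem_range_self i)).trans (le_max_left _ _)⟩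

section Prototiles

variable {X : Set (Coll d)} (hX : IsTilingSpace X) {l : ℕ} {D : Fin l → Set (Euc d)}
  (hD : IsPrototileSystem X D)
include hX hD

theorem exists_forall_dist_le :
    ∃ R > 0, ∀ P ∈ tiles X, ∀ x ∈ P, ∀ y ∈ P, dist x y ≤ R := by
  obtain ⟨R, hR, h⟩ := exists_pos_forall_ge fun i => Metric.diam (D i)
  refine ⟨R, hR, fun P hP => ?_⟩
  obtain ⟨i, t, rfl⟩ := hD.exists_eq P hP
  rintro _ ⟨x, hx, rfl⟩ _ ⟨y, hy, rfl⟩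
  simp only [vadd_eq_add, dist_add_left]
  exact (Metric.dist_le_diam_of_mem (hX.isTile (hD.mem i)).isCompact.isBounded hx hy).trans (h i)

theorem exists_forall_closedBall_subset :
    ∃ ε > 0, ∀ P ∈ tiles X, ∃ c, Metric.closedBall c ε ⊆ P := by
  have h (i : Fin l) : ∃ ε > 0, ∃ c, Metric.closedBall c ε ⊆ D i := by
    obtain ⟨c, hc⟩ := (hX.isTile (hD.mem i)).interior_nonempty
    obtain ⟨ε, hε, hs⟩ := Metric.nhds_basis_closedBall.mem_iff.1 (mem_interior_iff_mem_nhds.1 hc)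
    exact ⟨ε, hε, c, hs⟩
  choose ε hε c hc using h
  obtain ⟨δ, hδ, hle⟩ := exists_pos_forall_le ε hε
  refine ⟨δ, hδ, fun P hP => ?_⟩
  obtain ⟨i, t, rfl⟩ := hD.exists_eq P hP
  refine ⟨t + c i, ?_⟩
  have := Set.vadd_set_mono (a := t) ((Metric.closedBall_subset_closedBall (hle i)).trans (hc i))
  rwa [Metric.vadd_closedBall] at this

end Prototiles

variable {J : Type*} {S : J → Set (Euc d) → Coll d} {X : Set (Coll d)} {lam : J → ℝ}

/-- Finiteness of `J` gives growth rates independent of `b`, the source of uniformity for collar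
widths and supertile diameters. -/
theorem IsSubstSystem.exists_scale_bounds [Finite J] [Nonempty J] (h : IsSubstSystem X S lam) :
    ∃ μ ν : ℝ, 1 < μ ∧ 1 ≤ ν ∧ ∀ b n, μ ^ n ≤ scale lam b n ∧ scale lam b n ≤ ν ^ n := by
  obtain ⟨j, hj⟩ := Finite.exists_min lam
  obtain ⟨k, hk⟩ := Finite.exists_max lam
  refine ⟨lam j, lam k, h.one_lt j, (h.one_lt k).le, fun b n => ⟨?_, ?_⟩⟩
  · calc lam j ^ n = ∏ i ∈ Finset.range n, lam j := by simp
      _ ≤ _ := Finset.prod_le_prod (fun _ _ => (one_pos.trans (h.one_lt j)).le) fun i _ => hj _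
  · calc scale lam b n ≤ ∏ i ∈ Finset.range n, lam k :=
        Finset.prod_le_prod (fun _ _ => (one_pos.trans (h.one_lt _)).le) fun i _ => hk _
      _ = _ := by simp

/-! ### Uniform primitivity -/

theorem exists_vadd_mem_of_structureMatrix_pos {l : ℕ} {D : Fin l → Set (Euc d)}
    {s : Set (Euc d) → Coll d} {i j : Fin l} (h : 0 < structureMatrix D s i j) :
    ∃ t : Euc d, t +ᵥ D i ∈ s (D j) := by
  obtain ⟨P, hP, t, rfl⟩ := Set.nonempty_of_ncard_ne_zero h.ne'
  exact ⟨t, hP⟩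

/-- A positive entry of a product of nonnegative matrices comes from a chain of positive entries,
that is, from nested occurrences of prototiles. The order of the factors matches `iterSubst`: the
first matrix belongs to the substitution applied last. -/
theorem IsSubstSystem.exists_vadd_mem_of_prod_pos (h : IsSubstSystem X S lam) {l : ℕ}
    {D : Fin l → Set (Euc d)} (hD : ∀ i, D i ∈ tiles X) {n : ℕ} {b : ℕ → J} {i j : Fin l}
    (hpos : 0 < ((List.range n).map fun m => structureMatrix D (S (b m))).prod i j) :
    ∃ t : Euc d, t +ᵥ D i ∈ iterSubst S b n {D j} := by
  induction n generalizing b i with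
  | zero =>
    simp only [List.range_zero, List.map_nil, List.prod_nil, Matrix.one_apply] at hpos
    split_ifs at hpos with hij
    · exact ⟨0, by simp [hij]⟩
    · exact absurd hpos (lt_irrefl _)
  | succ n ih =>
    rw [List.range_succ_eq_map, List.map_cons, List.prod_cons, Matrix.mul_apply,
      Finset.sum_pos_iff] at hpos
    obtain ⟨k, -, hk⟩ := hpos
    obtain ⟨h1, h2⟩ := CanonicallyOrderedAdd.mul_pos.1 hk
    rw [List.map_map] at h2
    obtain ⟨t, ht⟩ := exists_vadd_mem_of_structureMatrix_pos h1
    obtain ⟨s, hs⟩ := ih (b := fun m => b (m + 1)) h2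
    rw [tail_succ_eq] at hs
    refine ⟨lam (b 0) • s + t, ?_⟩
    rw [iterSubst_succ, mem_substColl]
    refine ⟨_, hs, ?_⟩
    rw [h.map_vadd _ _ (hD k), add_vadd]
    exact Set.vadd_mem_vadd_set ht

/-- For a family of finite-range conditions on sequences over a finite alphabet, the ranges are
bounded. -/
theorem exists_forall_le_of_finite_alphabet [Finite J] {p : (ℕ → J) → ℕ → Prop}
    (hex : ∀ b, ∃ n, p b n) (hcongr : ∀ b c n, (∀ i < n, b i = c i) → p b n → p c n) :
    ∃ N, ∀ b, ∃ n ≤ N, p b n := by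
  choose n hn using hex
  -- With the finite alphabet discrete, the sequence space is compact and each condition holds on a
  -- cylinder around `b`; finitely many cylinders suffice.
  let _ : TopologicalSpace J := ⊥
  have : DiscreteTopology J := ⟨rfl⟩
  have hU (b : ℕ → J) : {c : ℕ → J | ∀ i < n b, b i = c i} ∈ 𝓝 b := by
    refine IsOpen.mem_nhds ?_ fun _ _ => rfl
    have : {c : ℕ → J | ∀ i < n b, b i = c i} =
        ⋂ i ∈ Finset.range (n b), (fun c : ℕ → J => c i) ⁻¹' {b i} := by
      ext c; simp [eq_comm]
    rw [this]
    exact isOpen_biInter_finset fun i _ => (isOpen_discrete _).preimage (continuous_apply i)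
  obtain ⟨t, -, ht⟩ := isCompact_univ.elim_nhds_subcover _ fun b _ => hU b
  refine ⟨t.sup n, fun c => ?_⟩
  obtain ⟨b, hb, hc⟩ := Set.mem_iUnion₂.1 (ht (Set.mem_univ c))
  exact ⟨n b, Finset.le_sup hb, hcongr b c _ hc (hn b)⟩

theorem IsSubstSystem.exists_forall_vadd_mem [Finite J] (h : IsSubstSystem X S lam) {l : ℕ}
    {D : Fin l → Set (Euc d)} (hD : IsPrototileSystem X D) (hprim : ∀ b, IsPrimitiveSeq D S b) :
    ∃ N, ∀ n ≥ N, ∀ b, ∀ P ∈ tiles X, ∀ Q ∈ tiles X, ∃ t : Euc d,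
      t +ᵥ Q ∈ iterSubst S b n {P} := by
  obtain ⟨N, hN⟩ := exists_forall_le_of_finite_alphabet
    (p := fun b n => ∀ i j, ∃ t : Euc d, t +ᵥ D i ∈ iterSubst S b n {D j})
    (fun b => by
      obtain ⟨N, hN⟩ := hprim b 0
      refine ⟨N + 1, fun i j => ?_⟩
      have := hN i j
      simp only [zero_add] at this
      exact h.exists_vadd_mem_of_prod_pos hD.mem this)
    (fun b c n hbc hp i j => by rw [← iterSubst_congr S hbc]; exact hp i j)
  refine ⟨N, fun n hn b P hP Q hQ => ?_⟩
  obtain ⟨m, hm, hp⟩ := hN b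
  -- The `k` surplus letters act first; any tile `T` they produce already contains all prototiles
  -- after the remaining `m` steps.
  obtain ⟨k, rfl⟩ := Nat.exists_eq_add_of_le (hm.trans hn)
  obtain ⟨i, u, rfl⟩ := hD.exists_eq Q hQ
  have hpk := h.iterSubst_mem_patches (tail b m) k (singleton_mem_patches hP)
  obtain ⟨T, hT⟩ := hpk.2.1
  have hTt := subset_tiles_of_mem_patches hpk hT
  obtain ⟨j, s, rfl⟩ := hD.exists_eq T hTt
  obtain ⟨t, ht⟩ := hp i j
  refine ⟨scale lam b m • s + t - u, ?_⟩
  rw [iterSubst_add, mem_iterSubst]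
  refine ⟨_, hT, ?_⟩
  rw [h.iterSubst_singleton_vadd _ _ (hD.mem j), ← add_vadd, sub_add_cancel, add_vadd]
  exact Set.vadd_mem_vadd_set ht

/-- Every tile, substituted often enough, contains a copy of every tile far from the boundary. -/
theorem IsSubstSystem.exists_deep_copy [Finite J] [Nonempty J] (h : IsSubstSystem X S lam) {l : ℕ}
    {D : Fin l → Set (Euc d)} (hD : IsPrototileSystem X D) (hprim : ∀ b, IsPrimitiveSeq D S b)
    (R : ℝ) : ∃ m > 0, ∀ b, ∀ P ∈ tiles X, ∀ Q ∈ tiles X, ∃ s : Euc d,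
      s +ᵥ Q ∈ iterSubst S b m {P} ∧
      ∀ z ∈ s +ᵥ Q, Metric.closedBall z R ⊆ scale lam b m • P := by
  obtain ⟨N, hN⟩ := h.exists_forall_vadd_mem hD hprim
  obtain ⟨R₀, hR₀, hdiam⟩ := exists_forall_dist_le h.isTilingSpace hD
  obtain ⟨ε, hε, hball⟩ := exists_forall_closedBall_subset h.isTilingSpace hD
  obtain ⟨μ, ν, hμ, hν, hsc⟩ := h.exists_scale_bounds
  -- The copy of `Q` lies within `ν ^ N * R₀` of the image of the centre `c` of a ball in `P`. The
  -- inflated ball must exceed this by `R`.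
  obtain ⟨k, hk⟩ := pow_unbounded_of_one_lt ((ν ^ N * R₀ + R) / ε) hμ
  refine ⟨N + (k + 1), by omega, fun b P hP Q hQ => ?_⟩
  obtain ⟨c, hc⟩ := hball P hP
  have hs1 := h.scale_pos b N
  have hs2 := h.scale_pos (tail b N) (k + 1)
  have hcs : scale lam (tail b N) (k + 1) • c ∈ supp (iterSubst S (tail b N) (k + 1) {P}) := by
    rw [h.supp_iterSubst_singleton _ _ hP]
    exact Set.smul_mem_smul_set (hc (Metric.mem_closedBall_self hε.le))
  obtain ⟨T, hT, hcT⟩ := hcs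
  have hTt : T ∈ tiles X := h.mem_tiles_of_mem (Set.singleton_subset_iff.2 hP) hT
  obtain ⟨s, hs⟩ := hN N le_rfl b T hTt Q hQ
  refine ⟨s, ?_, fun z hz w hw => ?_⟩
  · rw [iterSubst_add, mem_iterSubst]
    exact ⟨T, hT, hs⟩
  have hzT := h.subset_smul_of_mem hTt hs hz
  obtain ⟨z', hz', rfl⟩ := hzT
  have hzc : dist (scale lam b N • z') (scale lam b (N + (k + 1)) • c) ≤ ν ^ N * R₀ := by
    rw [scale_add, mul_smul, dist_smul₀, Real.norm_of_nonneg hs1.le]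
    exact mul_le_mul (hsc b N).2 (hdiam T hTt _ hz' _ hcT) dist_nonneg (by positivity)
  have hbig : ν ^ N * R₀ + R ≤ scale lam b (N + (k + 1)) * ε := by
    rw [div_lt_iff₀ hε] at hk
    refine hk.le.trans (mul_le_mul_of_nonneg_right ?_ hε.le)
    exact (pow_le_pow_right₀ hμ.le (by omega)).trans (hsc b _).1
  have hs := h.scale_pos b (N + (k + 1))
  rw [Set.mem_smul_set_iff_inv_smul_mem₀ hs.ne']
  apply hc
  rw [Metric.mem_closedBall]
  have hwc : dist w (scale lam b (N + (k + 1)) • c) ≤ scale lam b (N + (k + 1)) * ε :=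
    (dist_triangle _ _ _).trans <| by
      have := Metric.mem_closedBall.1 hw
      linarith
  have : dist w (scale lam b (N + (k + 1)) • c) = scale lam b (N + (k + 1)) *
      dist ((scale lam b (N + (k + 1)))⁻¹ • w) c := by
    conv_lhs => rw [← smul_inv_smul₀ hs.ne' w]
    rw [dist_smul₀, Real.norm_of_nonneg hs.le]
  rw [this] at hwc
  exact le_of_mul_le_mul_left hwc hs

end

section

variable {d : ℕ}

/-! ### Volumes -/

theorem volume_real_vadd (t : Euc d) (A : Set (Euc d)) :
    volume.real (t +ᵥ A) = volume.real A := by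
  simp only [Measure.real, measure_vadd]

theorem volume_real_smul {r : ℝ} (hr : 0 < r) (A : Set (Euc d)) :
    volume.real (r • A) = r ^ d * volume.real A := by
  simp only [Measure.real, Measure.addHaar_smul, finrank_euclideanSpace, Fintype.card_fin,
    ENNReal.toReal_mul, abs_of_pos (pow_pos hr d), ENNReal.toReal_ofReal (pow_pos hr d).le]

theorem IsTile.volume_lt_top {P : Set (Euc d)} (hP : IsTile P) : volume P < ⊤ :=
  hP.isCompact.measure_lt_top

theorem IsTile.volume_real_interior_pos {P : Set (Euc d)} (hP : IsTile P) :
    0 < volume.real (interior P) :=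
  ENNReal.toReal_pos (isOpen_interior.measure_pos volume hP.interior_nonempty).ne'
    ((measure_mono interior_subset).trans_lt hP.volume_lt_top).ne

theorem IsTile.volume_real_pos {P : Set (Euc d)} (hP : IsTile P) : 0 < volume.real P :=
  hP.volume_real_interior_pos.trans_le
    (measureReal_mono interior_subset hP.volume_lt_top.ne)

theorem exists_forall_volume_bounds {X : Set (Coll d)} (hX : IsTilingSpace X) {l : ℕ}
    {D : Fin l → Set (Euc d)} (hD : IsPrototileSystem X D) :
    ∃ v > 0, ∃ w > 0, ∀ P ∈ tiles X, v ≤ volume.real P ∧ volume.real P ≤ w := by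
  obtain ⟨v, hv, hle⟩ := exists_pos_forall_le (fun i => volume.real (D i))
    fun i => (hX.isTile (hD.mem i)).volume_real_pos
  obtain ⟨w, hw, hge⟩ := exists_pos_forall_ge (fun i => volume.real (D i))
  refine ⟨v, hv, w, hw, fun P hP => ?_⟩
  obtain ⟨i, t, rfl⟩ := hD.exists_eq P hP
  rw [volume_real_vadd]
  exact ⟨hle i, hge i⟩

variable {J : Type*} {S : J → Set (Euc d) → Coll d} {X : Set (Coll d)} {lam : J → ℝ}

/-- The boundaries of the tiles are null sets. -/
theorem IsSubstSystem.volume_frontier [Finite J] [Nonempty J] (h : IsSubstSystem X S lam)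
    {l : ℕ} {D : Fin l → Set (Euc d)} (hD : IsPrototileSystem X D)
    (hprim : ∀ b, IsPrimitiveSeq D S b) {P : Set (Euc d)} (hP : P ∈ tiles X) :
    volume (frontier P) = 0 := by
  have hX := h.isTilingSpace
  obtain ⟨i₁, t₁, rfl⟩ := hD.exists_eq P hP
  have : Nonempty (Fin l) := ⟨i₁⟩
  have hint (i : Fin l) := (hX.isTile (hD.mem i)).volume_real_interior_pos
  -- Let `κ` be the largest ratio of the volume of a tile to that of its interior, attained at `D
  -- i₀`. If `D i₀` is inflated until it contains a copy `Q₀` of itself in its interior, then the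
  -- boundary of `Q₀` also counts towards the volume of the inflated interior. Comparing volumes
  -- then forces `κ ≤ 1`.
  obtain ⟨i₀, hi₀⟩ := Finite.exists_max
    fun i => volume.real (D i) / volume.real (interior (D i))
  set κ := volume.real (D i₀) / volume.real (interior (D i₀)) with hκ
  have hκle {Q : Set (Euc d)} (hQ : Q ∈ tiles X) :
      volume.real Q ≤ κ * volume.real (interior Q) := by
    obtain ⟨i, t, rfl⟩ := hD.exists_eq Q hQ
    rw [interior_vadd, volume_real_vadd, volume_real_vadd]
    exact (div_le_iff₀ (hint i)).1 (hi₀ i)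
  have hκeq : volume.real (D i₀) = κ * volume.real (interior (D i₀)) :=
    (div_mul_cancel₀ _ (hint i₀).ne').symm
  have hκpos : 0 < κ := div_pos (hX.isTile (hD.mem i₀)).volume_real_pos (hint i₀)
  obtain ⟨m, -, hm⟩ := h.exists_deep_copy hD hprim 1
  let b : ℕ → J := fun _ => Classical.arbitrary J
  obtain ⟨s, hs, hdeep⟩ := hm b (D i₀) (hD.mem i₀) (D i₀) (hD.mem i₀)
  have hp := h.iterSubst_mem_patches b m (singleton_mem_patches (hD.mem i₀))
  have hpt := subset_tiles_of_mem_patches hp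
  have hpatch := hX.isPatch hp
  have hsc := h.scale_pos b m
  set Q₀ := s +ᵥ D i₀ with hQ₀
  have hQint : Q₀ ⊆ interior (scale lam b m • D i₀) := fun z hz =>
    mem_interior_iff_mem_nhds.2
      (mem_of_superset (Metric.closedBall_mem_nhds z one_pos) (hdeep z hz))
  set F := hp.1.toFinset with hF
  have hmem {Q : Set (Euc d)} : Q ∈ F ↔ Q ∈ iterSubst S b m {D i₀} := hp.1.mem_toFinset
  have hcompact : IsCompact (scale lam b m • D i₀) := (hX.isTile (hD.mem i₀)).isCompact.smul _
  classical
  have hupper : scale lam b m ^ d * volume.real (D i₀) ≤ ∑ Q ∈ F, volume.real Q := by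
    rw [← volume_real_smul hsc]
    refine le_trans ?_ (measureReal_biUnion_finset_le F fun Q => Q)
    rw [← h.supp_iterSubst_singleton b m (hD.mem i₀)]
    refine measureReal_mono (fun z ⟨Q, hQ, hz⟩ => Set.mem_biUnion (hmem.2 hQ) hz) ?_
    exact (F.isCompact_biUnion fun Q hQ =>
      (hX.isTile (hpt (hmem.1 hQ))).isCompact).measure_lt_top.ne
  -- `Q₀` enters with its full volume, the other tiles only with their interiors.
  have hlower : volume.real Q₀ + ∑ Q ∈ F.erase Q₀, volume.real (interior Q) ≤
      scale lam b m ^ d * volume.real (interior (D i₀)) := by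
    have hfin (Q : Set (Euc d)) (hQ : Q ∈ F.erase Q₀) : volume (interior Q) ≠ ⊤ :=
      ((measure_mono interior_subset).trans_lt
        (hX.isTile (hpt (hmem.1 (Finset.mem_of_mem_erase hQ)))).volume_lt_top).ne
    rw [← volume_real_smul hsc, ← interior_smul₀ hsc.ne',
      ← measureReal_biUnion_finset (f := interior) ?_
        (fun Q _ => isOpen_interior.measurableSet) hfin,
      ← measureReal_union ?_
        (Finset.measurableSet_biUnion _ fun Q _ => isOpen_interior.measurableSet)
        (hX.isTile (hpt hs)).volume_lt_top.ne
        (measure_biUnion_lt_top (F.erase Q₀).finite_toSet fun Q hQ => (hfin Q hQ).lt_top).ne]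
    · refine measureReal_mono (Set.union_subset hQint (Set.iUnion₂_subset fun Q hQ => ?_))
        ((measure_mono interior_subset).trans_lt hcompact.measure_lt_top).ne
      exact interior_mono (h.subset_smul_of_mem (hD.mem i₀)
        (hmem.1 (Finset.mem_of_mem_erase hQ)))
    · rw [Set.disjoint_iUnion₂_right]
      intro Q hQ
      rw [Set.disjoint_iff_inter_eq_empty, Set.inter_comm]
      by_contra hne
      exact (Finset.ne_of_mem_erase hQ) (hpatch.eq_of_interior_inter
        (hmem.1 (Finset.mem_of_mem_erase hQ)) hs (Set.nonempty_iff_ne_empty.2 hne))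
    · intro Q hQ R hR hne
      rw [Function.onFun, Set.disjoint_iff_inter_eq_empty]
      exact hpatch.disjoint Q (hmem.1 (Finset.mem_of_mem_erase hQ)) R
        (hmem.1 (Finset.mem_of_mem_erase hR)) hne
  have hsum : ∑ Q ∈ F, volume.real Q ≤ κ * ∑ Q ∈ F, volume.real (interior Q) := by
    rw [Finset.mul_sum]
    exact Finset.sum_le_sum fun Q hQ => hκle (hpt (hmem.1 hQ))
  rw [← Finset.add_sum_erase F (fun Q => volume.real (interior Q)) (hmem.2 hs)] at hsum
  have hQ₀w : volume.real Q₀ = volume.real (D i₀) := volume_real_vadd _ _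
  have hQ₀v : volume.real (interior Q₀) = volume.real (interior (D i₀)) := by
    rw [hQ₀, interior_vadd, volume_real_vadd]
  have hκ1 : κ ≤ 1 := by
    have h1 := mul_le_mul_of_nonneg_left hlower hκpos.le
    have h2 : scale lam b m ^ d * volume.real (D i₀) =
      κ * (scale lam b m ^ d * volume.real (interior (D i₀))) := by rw [hκeq]; ring
    have h3 : κ * volume.real (D i₀) ≤ κ * volume.real (interior (D i₀)) := by
      rw [hQ₀w] at h1
      rw [hQ₀v] at hsum
      linarith
    have h4 := le_of_mul_le_mul_left h3 hκpos
    exact (div_le_one (hint i₀)).2 h4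
  have htile := hX.isTile hP
  have hle : volume (t₁ +ᵥ D i₁) ≤ volume (interior (t₁ +ᵥ D i₁)) := by
    have h1 := (hκle hP).trans
      (mul_le_of_le_one_left htile.volume_real_interior_pos.le hκ1)
    exact (ENNReal.toReal_le_toReal htile.volume_lt_top.ne
      ((measure_mono interior_subset).trans_lt htile.volume_lt_top).ne).1 h1
  rw [frontier, htile.isCompact.isClosed.closure_eq,
    measure_sdiff interior_subset isOpen_interior.measurableSet.nullMeasurableSet
      ((measure_mono interior_subset).trans_lt htile.volume_lt_top).ne]
  exact tsub_eq_zero_of_le hle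

/-- The volume of a union of tiles is the sum of their volumes. -/
theorem volume_real_biUnion_of_frontier {F : Finset (Set (Euc d))} (hF : IsPatch (F : Coll d))
    (h0 : ∀ Q ∈ F, volume (frontier Q) = 0) :
    volume.real (⋃ Q ∈ F, Q) = ∑ Q ∈ F, volume.real Q := by
  refine measureReal_biUnion_finset₀ (f := fun Q => Q) ?_
    (fun Q hQ => (hF.isTile Q hQ).isCompact.measurableSet.nullMeasurableSet)
    (fun Q hQ => (hF.isTile Q hQ).volume_lt_top.ne)
  intro Q hQ R hR hne
  refine measure_mono_null ?_ (h0 Q hQ)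
  rintro x ⟨hxQ, hxR⟩
  refine ⟨subset_closure hxQ, fun hx => hne (hF.eq_of_interior_inter hQ hR ⟨x, hx, hxR⟩)⟩

/-- A packing bound for tiles. -/
theorem IsPatch.finite_and_ncard_mul_le {T : Coll d} (hT : IsPatch T)
    (h0 : ∀ Q ∈ T, volume (frontier Q) = 0) {v : ℝ} (hv : 0 < v)
    (hvol : ∀ Q ∈ T, v ≤ volume.real Q) {A : Set (Euc d)} (hA : volume A < ⊤)
    (hTA : ∀ Q ∈ T, Q ⊆ A) : T.Finite ∧ T.ncard * v ≤ volume.real A := by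
  have key (F : Finset (Set (Euc d))) (hF : (F : Coll d) ⊆ T) : F.card * v ≤ volume.real A := by
    calc F.card * v = ∑ Q ∈ F, v := by simp
      _ ≤ ∑ Q ∈ F, volume.real Q := Finset.sum_le_sum fun Q hQ => hvol Q (hF hQ)
      _ = volume.real (⋃ Q ∈ F, Q) :=
        (volume_real_biUnion_of_frontier (hT.mono hF) fun Q hQ => h0 Q (hF hQ)).symm
      _ ≤ volume.real A :=
        measureReal_mono (Set.iUnion₂_subset fun Q hQ => hTA Q (hF hQ)) hA.ne
  have hfin : T.Finite := by
    by_contra hinf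
    -- An infinite `T` would have finite subsets violating the bound `key`.
    obtain ⟨n, hn⟩ := exists_nat_gt (volume.real A / v)
    obtain ⟨F, hF, hcard⟩ := Set.Infinite.exists_subset_card_eq hinf n
    have := key F hF
    rw [hcard] at this
    rw [div_lt_iff₀ hv] at hn
    linarith
  refine ⟨hfin, ?_⟩
  rw [Set.ncard_eq_toFinset_card T hfin]
  exact key _ (by simp)

end

section

variable {d : ℕ}

/-! ### Limits of increasing sequences of patches -/

theorem tilingDist_le {x y p : Coll d} {ρ : ℝ} (hρ : 0 < ρ) (hρ' : ρ < √2 / 2)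
    (hx : p ∈ coveringPatches x (Metric.closedBall 0 (1 / ρ)))
    (hy : p ∈ coveringPatches y (Metric.closedBall 0 (1 / ρ))) : tilingDist x y ≤ ρ := by
  refine csInf_le ⟨0, ?_⟩ (Or.inr ⟨hρ, hρ', p, hx, p, hy, 0, by simpa using hρ.le, by simp⟩)
  rintro r (rfl | hr)
  · positivity
  · exact hr.1.le

theorem exists_of_tilingDist_lt {x y : Coll d} {ε : ℝ} (hε : ε ≤ √2 / 2)
    (hxy : tilingDist x y < ε) : ∃ ρ, 0 < ρ ∧ ρ < ε ∧ ∃ p ⊆ x,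
      Metric.closedBall 0 (1 / ρ) ⊆ supp p ∧ ∃ t : Euc d, ‖t‖ ≤ ρ ∧ t +ᵥ p ⊆ y := by
  unfold tilingDist at hxy
  obtain ⟨ρ, hρ, hlt⟩ := exists_lt_of_csInf_lt (Set.insert_nonempty _ _) hxy
  rcases hρ with rfl | ⟨h0, -, p, hp, q, hq, t, ht, rfl⟩
  · exact absurd hlt (not_lt.2 hε)
  · exact ⟨ρ, h0, hlt, p, hp.1, hp.2.2, t, ht, hq.1⟩

theorem isCompact_supp {X : Set (Coll d)} (hX : IsTilingSpace X) {p : Coll d}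
    (hp : p ∈ patches X) : IsCompact (supp p) :=
  hp.1.isCompact_sUnion fun _ hP => (hX.isTile (subset_tiles_of_mem_patches hp hP)).isCompact

theorem supp_nonempty {X : Set (Coll d)} (hX : IsTilingSpace X) {p : Coll d}
    (hp : p ∈ patches X) : (supp p).Nonempty := by
  obtain ⟨P, hP⟩ := hp.2.1
  exact (hX.isTile (subset_tiles_of_mem_patches hp hP)).nonempty.mono (subset_supp hP)

/-- If arbitrarily small translates of `P` belong to a tiling, so does `P`. -/
theorem IsPatch.mem_of_small_translates {z : Coll d} (hz : IsPatch z) {P : Set (Euc d)}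
    (hP : IsTile P) (hsmall : ∀ ε > 0, ∃ t : Euc d, ‖t‖ < ε ∧ t +ᵥ P ∈ z) : P ∈ z := by
  obtain ⟨c, hc⟩ := hP.interior_nonempty
  obtain ⟨δ, hδ, hball⟩ := Metric.isOpen_iff.1 isOpen_interior c hc
  obtain ⟨t, ht, htz⟩ := hsmall (δ / 2) (half_pos hδ)
  by_cases h0 : t = 0
  · simpa [h0] using htz
  -- If `t ≠ 0`, a strictly shorter translation `s` also yields a tile of `z`. The two tiles overlap
  -- in their interiors, hence coincide, forcing `t = s`.
  obtain ⟨s, hs, hsz⟩ := hsmall ‖t‖ (norm_pos_iff.2 h0)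
  have hmem : t + c ∈ s +ᵥ P := by
    rw [Set.mem_vadd_set_iff_neg_vadd_mem]
    apply interior_subset
    apply hball
    rw [Metric.mem_ball, dist_eq_norm, vadd_eq_add, show -s + (t + c) - c = t - s by abel]
    exact (norm_sub_le t s).trans_lt (by linarith)
  have hint : t + c ∈ interior (t +ᵥ P) := by
    rw [interior_vadd]
    exact Set.vadd_mem_vadd_set hc
  have := hP.vadd_injective (hz.eq_of_interior_inter htz hsz ⟨_, hint, hmem⟩)
  rw [this] at hs
  exact absurd hs (lt_irrefl _)

/-- Tilings extending the `x n` agree on larger and larger balls, hence form a Cauchy sequence. Its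
limit contains each tile of each `x n` up to arbitrarily small translations, hence exactly, and the
union already covers the space. -/
theorem iUnion_mem_of_monotone {X : Set (Coll d)} (hX : IsTilingSpace X)
    (hcomplete : IsCompleteTilingSpace X) {x : ℕ → Coll d} (hmono : Monotone x)
    (hx : ∀ n, x n ∈ patches X) {r : ℕ → ℝ} (hr : Tendsto r atTop atTop)
    (hball : ∀ n, Metric.closedBall 0 (r n) ⊆ supp (x n)) : ⋃ n, x n ∈ X := by
  choose z hzX hxz using fun n => (hx n).2.2
  have hsqrt : (1 : ℝ) < √2 := by
    rw [Real.lt_sqrt] <;> norm_num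
  have hcauchy : ∀ ε > 0, ∃ N, ∀ m ≥ N, ∀ n ≥ N, tilingDist (z m) (z n) < ε := by
    intro ε hε
    -- The cap `1 / 2` keeps `ρ` below the default distance `√2 / 2`.
    set ρ := min (ε / 2) (1 / 2) with hρ
    have hρ0 : 0 < ρ := lt_min (half_pos hε) one_half_pos
    obtain ⟨N, hN⟩ := (hr.eventually_ge_atTop (1 / ρ)).exists
    have hcov (n : ℕ) (hn : n ≥ N) :
        x N ∈ coveringPatches (z n) (Metric.closedBall 0 (1 / ρ)) :=
      ⟨(hmono hn).trans (hxz n), (isCompact_supp hX (hx N)).isBounded,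
        (Metric.closedBall_subset_closedBall hN).trans (hball N)⟩
    refine ⟨N, fun m hm n hn => ?_⟩
    refine (tilingDist_le hρ0 ?_ (hcov m hm) (hcov n hn)).trans_lt ?_
    · have := min_le_right (ε / 2) (1 / 2)
      linarith
    · have := min_le_left (ε / 2) (1 / 2)
      linarith
  obtain ⟨y, hy, hlim⟩ := hcomplete z hzX hcauchy
  have hypatch := (hX.isTiling y hy).isPatch
  have hsub : ⋃ n, x n ⊆ y := by
    refine Set.iUnion_subset fun j P hP => ?_
    have hPt := hX.isTile (subset_tiles_of_mem_patches (hx j) hP)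
    refine hypatch.mem_of_small_translates hPt fun ε hε => ?_
    obtain ⟨B, hB⟩ := hPt.isCompact.isBounded.subset_closedBall 0
    set B' := max B 1
    have hB' : 0 < B' := lt_max_of_lt_right one_pos
    set δ := min ε (min (1 / B') (√2 / 2)) with hδ
    have hδ0 : 0 < δ := lt_min hε (lt_min (by positivity) (by positivity))
    obtain ⟨n, hn, hnj⟩ := ((hlim.eventually (gt_mem_nhds hδ0)).and (eventually_ge_atTop j)).exists
    obtain ⟨ρ, hρ0, hρ, p, hp, hpball, t, ht, hty⟩ := exists_of_tilingDist_lt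
      ((min_le_right _ _).trans (min_le_right _ _)) hn
    refine ⟨t, ht.trans_lt (hρ.trans_le (min_le_left _ _)), hty (Set.vadd_mem_vadd_set ?_)⟩
    refine (hX.isTiling _ (hzX n)).isPatch.mem_of_subset_supp hp (hxz n (hmono hnj hP)) ?_
    refine (hB.trans (Metric.closedBall_subset_closedBall ?_)).trans hpball
    refine (le_max_left B 1).trans ?_
    rw [le_one_div hB' hρ0]
    exact (hρ.le.trans (min_le_right _ _)).trans (min_le_left _ _)
  have hsupp : supp (⋃ n, x n) = Set.univ := by
    refine Set.eq_univ_of_forall fun w => ?_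
    obtain ⟨n, hn⟩ := (hr.eventually_ge_atTop ‖w‖).exists
    exact supp_mono (Set.subset_iUnion x n) (hball n (by simpa using hn))
  have : ⋃ n, x n = y := hsub.antisymm fun P hP =>
    hypatch.mem_of_subset_supp hsub hP (by rw [hsupp]; exact Set.subset_univ _)
  rwa [this]

/-! ### Limit tilings -/

variable {J : Type*} {S : J → Set (Euc d) → Coll d} {X : Set (Coll d)} {lam : J → ℝ}

/-- A deep copy of `D₀` inside `S_c^m(D₀)`, with `c` a tail of `b`, is carried by `S_b^k` to a deep
copy of `S_b^k(D₀)` inside `S_b^(k+m)(D₀)`. Iterating gives the nested patches. -/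
theorem IsSubstSystem.exists_isLimitTiling [Finite J] [Nonempty J] (h : IsSubstSystem X S lam)
    {l : ℕ} {D : Fin l → Set (Euc d)} (hD : IsPrototileSystem X D)
    (hprim : ∀ b, IsPrimitiveSeq D S b) {D₀ : Set (Euc d)} (hD₀ : D₀ ∈ tiles X) (b : ℕ → J) :
    ∃ y, IsLimitTiling S D₀ b y := by
  obtain ⟨R, hR, hdiam⟩ := exists_forall_dist_le h.isTilingSpace hD
  obtain ⟨μ, ν, hμ, -, hsc⟩ := h.exists_scale_bounds
  obtain ⟨m, hm, hdeep⟩ := h.exists_deep_copy hD hprim R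
  choose s hs hball using fun c => hdeep c D₀ hD₀ D₀ hD₀
  obtain ⟨c, hc⟩ := (h.isTilingSpace.isTile hD₀).nonempty
  let k : ℕ → ℕ := fun n => n * m + 1
  -- The initial translation puts an image of `c ∈ D₀` at the origin; each later one makes the
  -- previous patch the chosen deep copy in the next.
  let t : ℕ → Euc d := fun n => Nat.rec (-(scale lam b (k 0) • c))
    (fun n t => t - scale lam b (k n) • s (tail b (k n))) n
  -- `r (n + 1)` bounds the diameter of the `n`-th support, and is also the `R`-margin of the deep
  -- copy after inflation.
  let r : ℕ → ℝ := fun n => Nat.rec 0 (fun n _ => scale lam b (k n) * R) n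
  have ht (n : ℕ) : t n = t (n + 1) + scale lam b (k n) • s (tail b (k n)) := by
    simp [t]
  have hk (n : ℕ) : k (n + 1) = k n + m := by simp only [k]; ring
  have hsupp (n : ℕ) : supp (t n +ᵥ iterSubst S b (k n) {D₀}) =
      t n +ᵥ (scale lam b (k n) • D₀) := by
    rw [supp_vadd, h.supp_iterSubst_singleton _ _ hD₀]
  have hr0 (n : ℕ) : 0 ≤ r n := by
    cases n with
    | zero => exact le_rfl
    | succ n => exact mul_nonneg (h.scale_pos _ _).le hR.le
  have hzero (n : ℕ) (h0 : (0 : Euc d) ∈ t n +ᵥ (scale lam b (k n) • D₀)) :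
      Metric.closedBall 0 (r (n + 1)) ⊆ t (n + 1) +ᵥ (scale lam b (k (n + 1)) • D₀) := by
    intro w hw
    have hpos := h.scale_pos b (k n)
    obtain ⟨_, ⟨p, hp, rfl⟩, hp0⟩ := h0
    simp only [vadd_eq_add] at hp0
    have htn : t (n + 1) = -(scale lam b (k n) • (s (tail b (k n)) + p)) := by
      rw [ht n] at hp0
      rw [smul_add, eq_neg_iff_add_eq_zero, ← add_assoc, hp0]
    have hmem := hball (tail b (k n)) _ (Set.vadd_mem_vadd_set (a := s (tail b (k n))) hp)
      (show (scale lam b (k n))⁻¹ • w + (s (tail b (k n)) + p) ∈ _ by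
        rw [vadd_eq_add, Metric.mem_closedBall, dist_eq_norm, add_sub_cancel_right, norm_smul,
          norm_inv, Real.norm_of_nonneg hpos.le, inv_mul_le_iff₀ hpos]
        simpa using hw)
    refine ⟨scale lam b (k n) • ((scale lam b (k n))⁻¹ • w + (s (tail b (k n)) + p)), ?_, ?_⟩
    · rw [hk, scale_add, mul_smul]
      exact Set.smul_mem_smul_set hmem
    · simp only [vadd_eq_add]
      rw [htn, smul_add _ _ (_ + p), smul_inv_smul₀ hpos.ne']
      abel
  have hcover (n : ℕ) : Metric.closedBall 0 (r n) ⊆ t n +ᵥ (scale lam b (k n) • D₀) := by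
    induction n with
    | zero =>
      intro w hw
      have hw0 : w = 0 := by simpa [r] using hw
      rw [hw0]
      exact ⟨scale lam b (k 0) • c, Set.smul_mem_smul_set hc, by simp [t]⟩
    | succ n ih => exact hzero n (ih (Metric.mem_closedBall_self (hr0 n)))
  refine ⟨_, t, k, r, fun n => Nat.succ_pos _, ?_, fun n => ?_, fun n => ?_, fun n => ?_, rfl⟩
  · rw [← tendsto_add_atTop_iff_nat 1]
    refine tendsto_atTop_mono (fun n => ?_)
      ((tendsto_pow_atTop_atTop_of_one_lt hμ).atTop_mul_const hR)
    refine mul_le_mul_of_nonneg_right (le_trans ?_ (hsc b (k n)).1) hR.le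
    exact pow_le_pow_right₀ hμ.le ((Nat.le_mul_of_pos_right n hm).trans (Nat.le_succ _))
  · rw [hk, iterSubst_add S b (k n) m, ht n, add_vadd,
      ← h.iterSubst_singleton_vadd b (k n) hD₀]
    exact Set.vadd_set_mono (iterSubst_mono S _ _ (Set.singleton_subset_iff.2 (hs _)))
  · rw [hsupp]
    have h0 := hcover n (Metric.mem_closedBall_self (hr0 n))
    obtain ⟨_, ⟨p, hp, rfl⟩, hp0⟩ := h0
    rintro _ ⟨_, ⟨q, hq, rfl⟩, rfl⟩
    rw [Metric.mem_closedBall]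
    simp only [vadd_eq_add] at hp0 ⊢
    rw [← hp0, dist_add_left, dist_smul₀, Real.norm_of_nonneg (h.scale_pos _ _).le]
    exact mul_le_mul_of_nonneg_left (hdiam D₀ hD₀ q hq p hp) (h.scale_pos _ _).le
  · rw [hsupp]
    exact hcover n

theorem IsSubstSystem.limitTiling_mem (h : IsSubstSystem X S lam)
    (hcomplete : IsCompleteTilingSpace X) {D₀ : Set (Euc d)} (hD₀ : D₀ ∈ tiles X) {b : ℕ → J}
    {y : Coll d} (hy : IsLimitTiling S D₀ b y) : y ∈ X := by
  obtain ⟨t, k, r, -, hr, hmono, -, hball, rfl⟩ := hy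
  exact iUnion_mem_of_monotone h.isTilingSpace hcomplete (monotone_nat_of_le_succ hmono)
    (fun n => h.isTilingSpace.vadd_mem_patches
      (h.iterSubst_mem_patches b _ (singleton_mem_patches hD₀)) _) hr hball

theorem IsTile.eq_univ_of_subsingleton [Subsingleton (Euc d)] {P : Set (Euc d)} (hP : IsTile P) :
    P = Set.univ := by
  obtain ⟨x, hx⟩ := hP.nonempty
  exact Set.eq_univ_of_forall fun y => Subsingleton.elim x y ▸ hx

theorem IsSubstSystem.exists_large_patch [Finite J] [Nonempty J] (h : IsSubstSystem X S lam)
    {D₀ : Set (Euc d)} (hD₀ : D₀ ∈ tiles X) {b : ℕ → J} {y : Coll d}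
    (hy : IsLimitTiling S D₀ b y) {F : Coll d} (hF : F.Finite) (hFy : F ⊆ y) (R : ℝ) (m : ℕ) :
    ∃ k ≥ m, ∃ t : Euc d, F ⊆ t +ᵥ iterSubst S b k {D₀} ∧ t +ᵥ iterSubst S b k {D₀} ⊆ y ∧
      Metric.closedBall 0 R ⊆ supp (t +ᵥ iterSubst S b k {D₀}) := by
  obtain ⟨t, k, r, -, hr, hmono, -, hball, rfl⟩ := hy
  have hX := h.isTilingSpace
  have hpat (k : ℕ) := h.iterSubst_mem_patches b k (singleton_mem_patches hD₀)
  have htile {k : ℕ} {t P : _} (hP : P ∈ t +ᵥ iterSubst S b k {D₀}) : IsTile P :=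
    hX.isTile (subset_tiles_of_mem_patches (hX.vadd_mem_patches (hpat k) t) hP)
  cases subsingleton_or_nontrivial (Euc d) with
  -- In dimension zero all levels give the same one-tile patch, so any `k` serves. In positive
  -- dimension, large balls in the support force the level to be large.
  | inl hsub =>
    have huniv (k : ℕ) (t : Euc d) : t +ᵥ iterSubst S b k {D₀} = {Set.univ} := by
      refine ((hpat k).2.1.vadd_set (a := t)).subset_singleton_iff.1 fun P hP => ?_
      exact (htile hP).eq_univ_of_subsingleton
    simp only [huniv, Set.iUnion_const] at hFy ⊢
    exact ⟨m, le_rfl, 0, hFy, le_rfl, by simp⟩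
  | inr hnon =>
    obtain ⟨μ, ν, -, hν, hsc⟩ := h.exists_scale_bounds
    have hmono := monotone_nat_of_le_succ hmono
    have hev : ∀ᶠ n in atTop, F ⊆ t n +ᵥ iterSubst S b (k n) {D₀} := by
      refine hF.eventually_all.2 fun P hP => ?_
      obtain ⟨n, hn⟩ := Set.mem_iUnion.1 (hFy hP)
      exact eventually_atTop.2 ⟨n, fun n' hn' => hmono hn' hn⟩
    obtain ⟨C, hC, hCD⟩ : ∃ C > 0, ∀ x ∈ D₀, ∀ y ∈ D₀, dist x y ≤ C :=
      ⟨Metric.diam D₀ + 1, by positivity, fun x hx y hy =>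
        (Metric.dist_le_diam_of_mem (hX.isTile hD₀).isCompact.isBounded hx hy).trans (by simp)⟩
    obtain ⟨n, hnF, hnR, hn0, hn⟩ := (hev.and ((hr.eventually_ge_atTop R).and
      ((hr.eventually_ge_atTop 0).and (hr.eventually_gt_atTop (ν ^ m * C))))).exists
    refine ⟨k n, ?_, t n, hnF, Set.subset_iUnion (fun n => t n +ᵥ iterSubst S b (k n) {D₀}) n,
      (Metric.closedBall_subset_closedBall hnR).trans (hball n)⟩
    by_contra hlt
    obtain ⟨v, hv⟩ := exists_norm_eq (Euc d) hn0
    have h1 := hball n (show v ∈ Metric.closedBall 0 (r n) by simp [hv])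
    have h2 := hball n (Metric.mem_closedBall_self hn0)
    rw [supp_vadd, h.supp_iterSubst_singleton _ _ hD₀] at h1 h2
    obtain ⟨_, ⟨p, hp, rfl⟩, hpv⟩ := h1
    obtain ⟨_, ⟨q, hq, rfl⟩, hq0⟩ := h2
    have : dist v 0 ≤ ν ^ m * C := by
      simp only [vadd_eq_add] at hpv hq0
      rw [← hpv, ← hq0, dist_add_left, dist_smul₀, Real.norm_of_nonneg (h.scale_pos _ _).le]
      exact mul_le_mul ((hsc b _).2.trans (pow_le_pow_right₀ hν (by omega))) (hCD p hp q hq)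
        dist_nonneg (by positivity)
    rw [dist_zero_right, hv] at this
    linarith

end

section

variable {d : ℕ}

/-! ### Points near the boundary -/

theorem mem_cthickening_frontier {A : Set (Euc d)} {x y : Euc d} (hx : x ∈ A) (hy : y ∉ A)
    {r : ℝ} (hr : dist x y ≤ r) :
    x ∈ Metric.cthickening r (frontier A) ∧ y ∈ Metric.cthickening r (frontier A) := by
  -- A segment from a point of `A` to a point outside crosses the frontier, by connectedness.
  obtain ⟨z, hz, hzA⟩ : (segment ℝ x y ∩ frontier A).Nonempty := by
    by_contra hne
    have hsub : segment ℝ x y ⊆ interior A ∪ interior Aᶜ := fun z hz => by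
      rw [← compl_frontier_eq_union_interior]
      exact fun hzA => hne ⟨z, hz, hzA⟩
    have hxi : x ∈ interior A := (hsub (left_mem_segment ℝ x y)).resolve_right
      fun h => interior_subset h hx
    have hyi : y ∈ interior Aᶜ := (hsub (right_mem_segment ℝ x y)).resolve_left
      fun h => hy (interior_subset h)
    obtain ⟨z, -, hz1, hz2⟩ := (convex_segment x y).isPreconnected _ _ isOpen_interior
      isOpen_interior hsub ⟨x, left_mem_segment ℝ x y, hxi⟩ ⟨y, right_mem_segment ℝ x y, hyi⟩
    exact interior_subset hz2 (interior_subset hz1)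
  have hsum := dist_add_dist_of_mem_segment hz
  refine ⟨Metric.mem_cthickening_of_dist_le _ z _ _ hzA ?_,
    Metric.mem_cthickening_of_dist_le _ z _ _ hzA ?_⟩
  · linarith [dist_nonneg (x := z) (y := y)]
  · rw [dist_comm]; linarith [dist_nonneg (x := x) (y := z)]

theorem cthickening_vadd (r : ℝ) (t : Euc d) (A : Set (Euc d)) :
    Metric.cthickening r (t +ᵥ A) = t +ᵥ Metric.cthickening r A := by
  ext x
  rw [Set.mem_vadd_set_iff_neg_vadd_mem, Metric.mem_cthickening_iff, Metric.mem_cthickening_iff,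
    ← Metric.infEDist_vadd t (-t +ᵥ x) A, vadd_neg_vadd]

theorem frontier_vadd (t : Euc d) (A : Set (Euc d)) : frontier (t +ᵥ A) = t +ᵥ frontier A := by
  rw [frontier, frontier, closure_vadd, interior_vadd, Set.vadd_set_sdiff]

/-- Thickenings of a compact null set have volume tending to zero. The second radius `s` allows one
bound for all `b`, whose collar widths `r` differ. -/
theorem exists_collar_bound {X : Set (Coll d)} (hX : IsTilingSpace X) {l : ℕ}
    {D : Fin l → Set (Euc d)} (hD : IsPrototileSystem X D)
    (hfr : ∀ P ∈ tiles X, volume (frontier P) = 0) :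
    ∃ θ : ℝ → ℝ, Tendsto θ (𝓝 0) (𝓝 0) ∧ ∀ r s, r ≤ s → ∀ P ∈ tiles X,
      volume.real (Metric.cthickening r (frontier P)) ≤ θ s := by
  refine ⟨fun r => ∑ i, volume.real (Metric.cthickening r (frontier (D i))), ?_, ?_⟩
  · suffices ∀ i, Tendsto (fun r => volume.real (Metric.cthickening r (frontier (D i))))
        (𝓝 0) (𝓝 0) by simpa using tendsto_finsetSum Finset.univ fun i _ => this i
    intro i
    have hc : IsCompact (frontier (D i)) :=
      (hX.isTile (hD.mem i)).isCompact.of_isClosed_subset isClosed_frontier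
        (hX.isTile (hD.mem i)).isCompact.isClosed.frontier_subset
    have := tendsto_measure_cthickening_of_isCompact (μ := volume) hc
    rw [hfr _ (hD.mem i)] at this
    exact (ENNReal.tendsto_toReal ENNReal.zero_ne_top).comp this
  · intro r s hrs P hP
    obtain ⟨i, t, rfl⟩ := hD.exists_eq P hP
    rw [frontier_vadd, cthickening_vadd, volume_real_vadd]
    refine le_trans ?_ (Finset.single_le_sum
      (f := fun i => volume.real (Metric.cthickening s (frontier (D i))))
      (fun _ _ => measureReal_nonneg) (Finset.mem_univ i))
    refine measureReal_mono (Metric.cthickening_mono hrs _) ?_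
    have hb : Bornology.IsBounded (frontier (D i)) :=
      (hX.isTile (hD.mem i)).isCompact.isBounded.subset
        (hX.isTile (hD.mem i)).isCompact.isClosed.frontier_subset
    exact hb.cthickening.measure_lt_top.ne

/-! ### Counting copies of a patch -/

/-- The translations that move the patch `x'` into the patch `p`. -/
def copies (x' p : Coll d) : Set (Euc d) := {t | t +ᵥ x' ⊆ p}

theorem copies_mono (x' : Coll d) {p q : Coll d} (hpq : p ⊆ q) : copies x' p ⊆ copies x' q :=
  fun _ ht => Set.Subset.trans ht hpq

theorem copies_vadd (x' p : Coll d) (s : Euc d) : copies x' (s +ᵥ p) = s +ᵥ copies x' p := by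
  ext t
  rw [Set.mem_vadd_set_iff_neg_vadd_mem]
  change t +ᵥ x' ⊆ s +ᵥ p ↔ (-s +ᵥ t) +ᵥ x' ⊆ p
  rw [Set.subset_vadd_set_iff, vadd_eq_add, add_vadd]

theorem ncard_copies_vadd (x' p : Coll d) (s : Euc d) :
    (copies x' (s +ᵥ p)).ncard = (copies x' p).ncard := by
  rw [copies_vadd]
  exact Set.ncard_image_of_injective _ (AddAction.injective s)

variable {J : Type*} {S : J → Set (Euc d) → Coll d} {X : Set (Coll d)} {lam : J → ℝ}

theorem IsTilingSpace.finite_copies (hX : IsTilingSpace X) {x' p : Coll d}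
    (hx' : x' ∈ patches X) (hp : p.Finite) : (copies x' p).Finite := by
  obtain ⟨P, hP⟩ := hx'.2.1
  have hPt := hX.isTile (subset_tiles_of_mem_patches hx' hP)
  refine (hp.preimage (f := fun t : Euc d => t +ᵥ P) hPt.vadd_injective.injOn).subset fun t ht => ?_
  exact ht (Set.vadd_mem_vadd_set hP)

/-- The copies of `x'` in `S_b^m(p)` whose tile at the position of `P₀` lies in `S_b^m(Q)`, but
which are not contained in `S_b^m(Q)`. -/
def crossings (S : J → Set (Euc d) → Coll d) (b : ℕ → J) (m : ℕ) (x' p : Coll d)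
    (P₀ Q : Set (Euc d)) : Set (Euc d) :=
  {t | t +ᵥ P₀ ∈ iterSubst S b m {Q} ∧ t ∈ copies x' (iterSubst S b m p) ∧
    t ∉ copies x' (iterSubst S b m {Q})}

/-- For a crossing copy, the tile at the position of `P₀` lies in the inflated `Q`, while another of
its tiles has a point outside. Every point of the former is thus within `ρ` of the boundary of the
inflated `Q`, and tiles in that collar are counted by volume. -/
theorem IsSubstSystem.ncard_crossings_le (h : IsSubstSystem X S lam)
    (hfr : ∀ P ∈ tiles X, volume (frontier P) = 0) {v : ℝ} (hv : 0 < v)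
    (hvol : ∀ P ∈ tiles X, v ≤ volume.real P) {x' p : Coll d} (hx' : x' ∈ patches X)
    (hp : p ∈ patches X) {P₀ Q : Set (Euc d)} (hP₀ : P₀ ∈ x') (hQ : Q ∈ p) {ρ : ℝ}
    (hρ : ∀ z ∈ supp x', ∀ w ∈ supp x', dist z w ≤ ρ) (b : ℕ → J) (m : ℕ) :
    (crossings S b m x' p P₀ Q).ncard * v ≤ scale lam b m ^ d *
      volume.real (Metric.cthickening (ρ / scale lam b m) (frontier Q)) := by
  have hX := h.isTilingSpace
  have hs := h.scale_pos b m
  have hQt := subset_tiles_of_mem_patches hp hQ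
  have hP₀t := hX.isTile (subset_tiles_of_mem_patches hx' hP₀)
  have himg : (fun t : Euc d => t +ᵥ P₀) '' crossings S b m x' p P₀ Q ⊆
      iterSubst S b m {Q} := by
    rintro _ ⟨t, ht, rfl⟩
    exact ht.1
  have hpatQ := h.iterSubst_mem_patches b m (singleton_mem_patches hQt)
  have htiles := himg.trans (subset_tiles_of_mem_patches hpatQ)
  rw [← Set.ncard_image_of_injective _ hP₀t.vadd_injective, ← volume_real_smul hs]
  have hb : Bornology.IsBounded (scale lam b m •
      Metric.cthickening (ρ / scale lam b m) (frontier Q)) := by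
    have hc := (hX.isTile hQt).isCompact
    exact ((hc.isBounded.subset hc.isClosed.frontier_subset).cthickening).smul₀ _
  refine (((hX.isPatch hpatQ).mono himg).finite_and_ncard_mul_le (fun P hP => hfr P (htiles hP)) hv
    (fun P hP => hvol P (htiles hP)) hb.measure_lt_top ?_).2
  rintro _ ⟨t, ⟨htQ, htp, hnot⟩, rfl⟩ z hz
  obtain ⟨R, hR, hRQ⟩ := Set.not_subset.1 hnot
  obtain ⟨w, hw, hwQ⟩ := Set.not_subset.1 (h.not_subset_smul_of_mem hp hQ (htp hR) hRQ)
  have hzQ := h.subset_smul_of_mem hQt htQ hz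
  rw [Set.mem_smul_set_iff_inv_smul_mem₀ hs.ne'] at hzQ hwQ ⊢
  refine (mem_cthickening_frontier hzQ hwQ ?_).1
  rw [dist_smul₀, norm_inv, Real.norm_of_nonneg hs.le, inv_mul_eq_div]
  refine div_le_div_of_nonneg_right ?_ hs.le
  obtain ⟨z', hz', rfl⟩ := hz
  obtain ⟨R', hR', rfl⟩ := hR
  obtain ⟨w', hw', rfl⟩ := hw
  simp only [vadd_eq_add, dist_add_left]
  exact hρ _ (subset_supp hP₀ hz') _ (subset_supp hR' hw')

theorem IsSubstSystem.exists_crossings_bound [Finite J] [Nonempty J] (h : IsSubstSystem X S lam)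
    {l : ℕ} {D : Fin l → Set (Euc d)} (hD : IsPrototileSystem X D)
    (hprim : ∀ b, IsPrimitiveSeq D S b) {x' : Coll d} (hx' : x' ∈ patches X)
    {P₀ : Set (Euc d)} (hP₀ : P₀ ∈ x') :
    ∃ η : ℕ → ℝ, (∀ m, 0 ≤ η m) ∧ Tendsto η atTop (𝓝 0) ∧ ∀ b m, ∀ p ∈ patches X, ∀ Q ∈ p,
      ((crossings S b m x' p P₀ Q).ncard : ℝ) ≤ η m * (scale lam b m ^ d * volume.real Q) := by
  have hX := h.isTilingSpace
  have hfr (P : Set (Euc d)) (hP : P ∈ tiles X) := h.volume_frontier hD hprim hP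
  obtain ⟨θ, hθ, hθb⟩ := exists_collar_bound hX hD hfr
  obtain ⟨v, hv, w, -, hvw⟩ := exists_forall_volume_bounds hX hD
  obtain ⟨μ, ν, hμ, -, hsc⟩ := h.exists_scale_bounds
  have hb := (isCompact_supp hX hx').isBounded
  set ρ := Metric.diam (supp x')
  have hlim : Tendsto (fun m : ℕ => ρ / μ ^ m) atTop (𝓝 0) :=
    (tendsto_pow_atTop_atTop_of_one_lt hμ).const_div_atTop ρ
  have hP₀t := subset_tiles_of_mem_patches hx' hP₀
  -- One division by `v` turns collar volume into a number of tiles; the other comes from `v ≤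
  -- volume.real Q`.
  refine ⟨fun m => θ (ρ / μ ^ m) / v / v, fun m => ?_, ?_, fun b m p hp Q hQ => ?_⟩
  · exact div_nonneg (div_nonneg
      (measureReal_nonneg.trans (hθb _ _ le_rfl P₀ hP₀t)) hv.le) hv.le
  · simpa using ((hθ.comp hlim).div_const v).div_const v
  have hQt := subset_tiles_of_mem_patches hp hQ
  have hμm : 0 < μ ^ m := by positivity
  have h1 := h.ncard_crossings_le hfr hv (fun P hP => (hvw P hP).1) hx' hp hP₀ hQ
    (fun z hz w hw => Metric.dist_le_diam_of_mem hb hz hw) b m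
  have h2 := hθb (ρ / scale lam b m) (ρ / μ ^ m)
    (div_le_div_of_nonneg_left Metric.diam_nonneg hμm (hsc b m).1) Q hQt
  have hsd := pow_pos (h.scale_pos b m) d
  have h3 : 0 ≤ θ (ρ / μ ^ m) := measureReal_nonneg.trans h2
  rw [← le_div_iff₀ hv] at h1
  refine h1.trans ?_
  rw [div_mul_eq_mul_div, le_div_iff₀ hv]
  calc _ ≤ scale lam b m ^ d * θ (ρ / μ ^ m) / v * v := by gcongr
    _ = θ (ρ / μ ^ m) / v * (scale lam b m ^ d * v) := by ring
    _ ≤ _ := by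
      have := (hvw Q hQt).1
      gcongr

/-- No copy is counted twice: its marked tile lies in the image of only one tile of `p`. -/
theorem IsSubstSystem.sum_ncard_copies_le (h : IsSubstSystem X S lam) {x' p : Coll d}
    (hx' : x' ∈ patches X) (hp : p ∈ patches X) (b : ℕ → J) (m : ℕ) {F : Finset (Set (Euc d))}
    (hF : (F : Coll d) ⊆ p) {T : Set (Euc d)} (hT : T.Finite)
    (hFT : ∀ Q ∈ F, copies x' (iterSubst S b m {Q}) ⊆ T) :
    ∑ Q ∈ F, (copies x' (iterSubst S b m {Q})).ncard ≤ T.ncard := by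
  obtain ⟨P₀, hP₀⟩ := hx'.2.1
  rw [← finsum_mem_coe_finset, ← F.finite_toSet.ncard_biUnion
    (fun Q hQ => hT.subset (hFT Q hQ))]
  · exact Set.ncard_le_ncard (Set.iUnion₂_subset hFT) hT
  · intro Q hQ R hR hne
    refine Set.disjoint_left.2 fun t htQ htR => hne ?_
    exact h.eq_of_mem_iterSubst hp (hF hQ) (hF hR) (htQ (Set.vadd_mem_vadd_set hP₀))
      (htR (Set.vadd_mem_vadd_set hP₀))

/-- Each copy is charged to the tile `Q` whose image contains the marked tile; it lies in that image
or is a crossing. -/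
theorem IsSubstSystem.ncard_le_sum (h : IsSubstSystem X S lam) {x' p : Coll d}
    (hx' : x' ∈ patches X) (hp : p ∈ patches X) {P₀ : Set (Euc d)} (hP₀ : P₀ ∈ x') (b : ℕ → J)
    (m : ℕ) {F : Finset (Set (Euc d))} (hF : (F : Coll d) ⊆ p) {T : Set (Euc d)}
    (hT : T ⊆ copies x' (iterSubst S b m p))
    (hTF : ∀ t ∈ T, ∀ Q ∈ p, t +ᵥ P₀ ∈ iterSubst S b m {Q} → Q ∈ F) :
    T.ncard ≤ ∑ Q ∈ F, ((copies x' (iterSubst S b m {Q})).ncard +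
      (crossings S b m x' p P₀ Q).ncard) := by
  have hfin {q : Coll d} (hq : q ∈ patches X) :=
    h.isTilingSpace.finite_copies hx' (h.iterSubst_mem_patches b m hq).1
  have hsub : T ⊆ ⋃ Q ∈ F, (copies x' (iterSubst S b m {Q}) ∪ crossings S b m x' p P₀ Q) := by
    intro t ht
    obtain ⟨Q, hQ, htQ⟩ := (mem_iterSubst S b m p).1 (hT ht (Set.vadd_mem_vadd_set hP₀))
    refine Set.mem_biUnion (hTF t ht Q hQ htQ) ?_
    by_cases hc : t ∈ copies x' (iterSubst S b m {Q})
    · exact Or.inl hc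
    · exact Or.inr ⟨htQ, hT ht, hc⟩
  refine (Set.ncard_le_ncard hsub ?_).trans ((F.set_ncard_biUnion_le _).trans
    (Finset.sum_le_sum fun Q _ => Set.ncard_union_le _ _))
  refine F.finite_toSet.biUnion fun Q hQ => (hfin (singleton_mem_patches
    (subset_tiles_of_mem_patches hp (hF hQ)))).union ((hfin hp).subset fun t ht => ht.2.1)

end

section

variable {d : ℕ} {J : Type*}

/-! ### Densities of copies in iterated substitutions -/

/-- The number of copies of `x'` in `S_b^m(Q)` per unit of volume. -/
noncomputable def density (S : J → Set (Euc d) → Coll d) (lam : J → ℝ) (x' : Coll d) (b : ℕ → J)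
    (m : ℕ) (Q : Set (Euc d)) : ℝ :=
  (copies x' (iterSubst S b m {Q})).ncard / (scale lam b m ^ d * volume.real Q)

variable {S : J → Set (Euc d) → Coll d} {X : Set (Coll d)} {lam : J → ℝ} {x' : Coll d}

theorem IsSubstSystem.density_mul (h : IsSubstSystem X S lam) (b : ℕ → J) (m : ℕ)
    {Q : Set (Euc d)} (hQ : Q ∈ tiles X) :
    density S lam x' b m Q * (scale lam b m ^ d * volume.real Q) =
      (copies x' (iterSubst S b m {Q})).ncard :=
  div_mul_cancel₀ _ (mul_pos (pow_pos (h.scale_pos b m) d)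
    (h.isTilingSpace.isTile hQ).volume_real_pos).ne'

theorem IsSubstSystem.density_vadd (h : IsSubstSystem X S lam) (b : ℕ → J) (m : ℕ)
    {Q : Set (Euc d)} (hQ : Q ∈ tiles X) (t : Euc d) :
    density S lam x' b m (t +ᵥ Q) = density S lam x' b m Q := by
  rw [density, h.iterSubst_singleton_vadd b m hQ, ncard_copies_vadd, volume_real_vadd, density]

theorem IsSubstSystem.density_nonneg (h : IsSubstSystem X S lam) (b : ℕ → J) (m : ℕ)
    (Q : Set (Euc d)) : 0 ≤ density S lam x' b m Q :=
  div_nonneg (Nat.cast_nonneg _)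
    (mul_nonneg (pow_nonneg (h.scale_pos b m).le d) measureReal_nonneg)

theorem IsSubstSystem.mul_sum_volume_le (h : IsSubstSystem X S lam) {p : Coll d}
    (hx' : x' ∈ patches X) (hp : p ∈ patches X) (b : ℕ → J) (m : ℕ) {F : Finset (Set (Euc d))}
    (hF : (F : Coll d) ⊆ p) {T : Set (Euc d)} (hT : T.Finite)
    (hFT : ∀ Q ∈ F, copies x' (iterSubst S b m {Q}) ⊆ T) {A : ℝ}
    (hA : ∀ Q ∈ F, A ≤ density S lam x' b m Q) :
    A * (scale lam b m ^ d * ∑ Q ∈ F, volume.real Q) ≤ T.ncard := by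
  refine le_trans ?_ (Nat.cast_le.2 (h.sum_ncard_copies_le hx' hp b m hF hT hFT))
  push_cast
  rw [Finset.mul_sum, Finset.mul_sum]
  refine Finset.sum_le_sum fun Q hQ => ?_
  rw [← h.density_mul b m (subset_tiles_of_mem_patches hp (hF hQ))]
  exact mul_le_mul_of_nonneg_right (hA Q hQ)
    (mul_nonneg (pow_nonneg (h.scale_pos b m).le d) measureReal_nonneg)

theorem IsSubstSystem.ncard_le_sum_density (h : IsSubstSystem X S lam) {p : Coll d}
    (hx' : x' ∈ patches X) (hp : p ∈ patches X) {P₀ : Set (Euc d)} (hP₀ : P₀ ∈ x') {b : ℕ → J}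
    {m : ℕ} {η : ℝ} (hη : ∀ Q ∈ p, ((crossings S b m x' p P₀ Q).ncard : ℝ) ≤
      η * (scale lam b m ^ d * volume.real Q))
    {F : Finset (Set (Euc d))} (hF : (F : Coll d) ⊆ p) {T : Set (Euc d)}
    (hT : T ⊆ copies x' (iterSubst S b m p))
    (hTF : ∀ t ∈ T, ∀ Q ∈ p, t +ᵥ P₀ ∈ iterSubst S b m {Q} → Q ∈ F) :
    (T.ncard : ℝ) ≤
      ∑ Q ∈ F, (density S lam x' b m Q + η) * (scale lam b m ^ d * volume.real Q) := by
  refine (Nat.cast_le.2 (h.ncard_le_sum hx' hp hP₀ b m hF hT hTF)).trans ?_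
  push_cast
  refine Finset.sum_le_sum fun Q hQ => ?_
  rw [add_mul, h.density_mul b m (subset_tiles_of_mem_patches hp (hF hQ))]
  exact add_le_add_right (hη Q (hF hQ)) _

theorem IsSubstSystem.sum_volume_iterSubst (h : IsSubstSystem X S lam)
    (hfr : ∀ P ∈ tiles X, volume (frontier P) = 0) (b : ℕ → J) (k : ℕ) {P : Set (Euc d)}
    (hP : P ∈ tiles X) {F : Finset (Set (Euc d))}
    (hF : (F : Coll d) = iterSubst S b k {P}) :
    ∑ Q ∈ F, volume.real Q = scale lam b k ^ d * volume.real P := by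
  have hp := h.iterSubst_mem_patches b k (singleton_mem_patches hP)
  rw [← hF] at hp
  rw [← volume_real_biUnion_of_frontier (h.isTilingSpace.isPatch hp)
    fun Q hQ => hfr Q (subset_tiles_of_mem_patches hp hQ),
    ← volume_real_smul (h.scale_pos b k), ← h.supp_iterSubst_singleton b k hP, ← hF, supp,
    Set.sUnion_eq_biUnion]
  rfl

theorem IsSubstSystem.density_le (h : IsSubstSystem X S lam)
    (hfr : ∀ P ∈ tiles X, volume (frontier P) = 0) {v : ℝ} (hv : 0 < v)
    (hvol : ∀ P ∈ tiles X, v ≤ volume.real P) (hx' : x' ∈ patches X) (b : ℕ → J) (m : ℕ)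
    {Q : Set (Euc d)} (hQ : Q ∈ tiles X) : density S lam x' b m Q ≤ 1 / v := by
  have hX := h.isTilingSpace
  obtain ⟨P₀, hP₀⟩ := hx'.2.1
  have hP₀t := hX.isTile (subset_tiles_of_mem_patches hx' hP₀)
  have hp := h.iterSubst_mem_patches b m (singleton_mem_patches hQ)
  have hs := h.scale_pos b m
  have himg : (fun t : Euc d => t +ᵥ P₀) '' copies x' (iterSubst S b m {Q}) ⊆
      iterSubst S b m {Q} := by
    rintro _ ⟨t, ht, rfl⟩
    exact ht (Set.vadd_mem_vadd_set hP₀)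
  have := (((hX.isPatch hp).mono himg).finite_and_ncard_mul_le
    (fun P hP => hfr P (subset_tiles_of_mem_patches hp (himg hP))) hv
    (fun P hP => hvol P (subset_tiles_of_mem_patches hp (himg hP)))
    ((hX.isTile hQ).isCompact.smul (scale lam b m)).measure_lt_top
    fun P hP => h.subset_smul_of_mem hQ (himg hP)).2
  rw [Set.ncard_image_of_injective _ hP₀t.vadd_injective, volume_real_smul hs] at this
  rw [density, div_le_div_iff₀ (mul_pos (pow_pos hs d) (hX.isTile hQ).volume_real_pos) hv, one_mul]
  exact this

section Steps

variable (h : IsSubstSystem X S lam) (hfr : ∀ P ∈ tiles X, volume (frontier P) = 0)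
  (hx' : x' ∈ patches X) {b : ℕ → J} {m : ℕ} {P : Set (Euc d)} (hP : P ∈ tiles X)
include h hfr hx' hP

theorem IsSubstSystem.le_density_add {A : ℝ}
    (hA : ∀ Q ∈ tiles X, A ≤ density S lam x' b m Q) (k : ℕ) :
    A ≤ density S lam x' b (m + k) P := by
  have hp := h.iterSubst_mem_patches (tail b m) k (singleton_mem_patches hP)
  have hp' := h.iterSubst_mem_patches b (m + k) (singleton_mem_patches hP)
  have hsum := h.sum_volume_iterSubst hfr (tail b m) k hP hp.1.coe_toFinset
  have key := h.mul_sum_volume_le hx' hp b m (F := hp.1.toFinset) (by simp)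
    (h.isTilingSpace.finite_copies hx' hp'.1) (fun Q hQ => copies_mono x' ?_)
    (fun Q hQ => hA Q (subset_tiles_of_mem_patches hp (hp.1.mem_toFinset.1 hQ)))
  · rw [hsum, ← mul_assoc (_ ^ d), ← mul_pow, ← scale_add, ← h.density_mul b _ hP] at key
    exact le_of_mul_le_mul_right key (mul_pos (pow_pos (h.scale_pos b _) d)
      (h.isTilingSpace.isTile hP).volume_real_pos)
  · rw [iterSubst_add]
    exact iterSubst_mono S b m (Set.singleton_subset_iff.2 (hp.1.mem_toFinset.1 hQ))

/-- The upper count is `B + η` per unit of volume, less the deficits `B - density` weighted by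
volume. All deficits are nonnegative, and keeping a single one is what yields the contraction in
`IsSubstSystem.exists_density_limit`. -/
theorem IsSubstSystem.density_add_mul_le {P₀ : Set (Euc d)} (hP₀ : P₀ ∈ x') {η : ℝ}
    (hη : ∀ p ∈ patches X, ∀ Q ∈ p, ((crossings S b m x' p P₀ Q).ncard : ℝ) ≤
      η * (scale lam b m ^ d * volume.real Q)) {B : ℝ}
    (hB : ∀ Q ∈ tiles X, density S lam x' b m Q ≤ B) {k : ℕ} {Q : Set (Euc d)}
    (hQ : Q ∈ iterSubst S (tail b m) k {P}) :
    density S lam x' b (m + k) P * (scale lam (tail b m) k ^ d * volume.real P) ≤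
      (B + η) * (scale lam (tail b m) k ^ d * volume.real P) -
        (B - density S lam x' b m Q) * volume.real Q := by
  have hp := h.iterSubst_mem_patches (tail b m) k (singleton_mem_patches hP)
  have hs := pow_pos (h.scale_pos b m) d
  have hsum := h.sum_volume_iterSubst hfr (tail b m) k hP hp.1.coe_toFinset
  have key := h.ncard_le_sum_density hx' hp hP₀ (hη _ hp) (F := hp.1.toFinset) (by simp)
    (T := copies x' (iterSubst S b (m + k) {P})) (by rw [iterSubst_add])
    (fun t _ Q hQ _ => hp.1.mem_toFinset.2 hQ)
  have hone : (B - density S lam x' b m Q) * volume.real Q ≤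
      ∑ Q ∈ hp.1.toFinset, (B - density S lam x' b m Q) * volume.real Q :=
    Finset.single_le_sum (f := fun Q => (B - density S lam x' b m Q) * volume.real Q)
      (fun Q hQ => mul_nonneg
        (sub_nonneg.2 (hB Q (subset_tiles_of_mem_patches hp (hp.1.mem_toFinset.1 hQ))))
        measureReal_nonneg) (hp.1.mem_toFinset.2 hQ)
  have heq : ∑ Q ∈ hp.1.toFinset,
      (density S lam x' b m Q + η) * (scale lam b m ^ d * volume.real Q) =
      scale lam b m ^ d * ((B + η) * (scale lam (tail b m) k ^ d * volume.real P) -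
        ∑ Q ∈ hp.1.toFinset, (B - density S lam x' b m Q) * volume.real Q) := by
    rw [← hsum, Finset.mul_sum, ← Finset.sum_sub_distrib, Finset.mul_sum]
    exact Finset.sum_congr rfl fun Q _ => by ring
  rw [heq, ← h.density_mul b _ hP, scale_add, mul_pow, mul_assoc (_ ^ d), mul_left_comm] at key
  have := le_of_mul_le_mul_left key hs
  linarith

theorem IsSubstSystem.density_add_le {P₀ : Set (Euc d)} (hP₀ : P₀ ∈ x') {η : ℝ}
    (hη : ∀ p ∈ patches X, ∀ Q ∈ p, ((crossings S b m x' p P₀ Q).ncard : ℝ) ≤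
      η * (scale lam b m ^ d * volume.real Q)) {B : ℝ}
    (hB : ∀ Q ∈ tiles X, density S lam x' b m Q ≤ B) (k : ℕ) :
    density S lam x' b (m + k) P ≤ B + η := by
  have hp := h.iterSubst_mem_patches (tail b m) k (singleton_mem_patches hP)
  obtain ⟨Q, hQ⟩ := hp.2.1
  have hQt := subset_tiles_of_mem_patches hp hQ
  have h1 := h.density_add_mul_le hfr hx' hP hP₀ hη hB hQ
  have h2 : 0 ≤ (B - density S lam x' b m Q) * volume.real Q :=
    mul_nonneg (sub_nonneg.2 (hB Q hQt)) measureReal_nonneg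
  exact le_of_mul_le_mul_right (h1.trans (sub_le_self _ h2))
    (mul_pos (pow_pos (h.scale_pos _ _) d) (h.isTilingSpace.isTile hP).volume_real_pos)

end Steps

/-- A uniform contraction with vanishing errors forces convergence to zero. -/
theorem exists_uniform_small {β : Type*} {u : β → ℕ → ℝ} {η : ℕ → ℝ} {c C : ℝ} {K : ℕ}
    (hc : 0 < c) (hc1 : c ≤ 1) (hC : ∀ b m, u b m ≤ C)
    (hη : Tendsto η atTop (𝓝 0))
    (hstep : ∀ b m, u b (m + K) ≤ (1 - c) * u b m + η m) {ε : ℝ} (hε : 0 < ε) :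
    ∃ m, η m ≤ ε ∧ ∀ b, u b m ≤ ε := by
  -- With errors at most `c * (ε / 2)`, the value `ε / 2` is the fixed point of the recursion.
  have hev : ∀ᶠ m in atTop, η m ≤ c * (ε / 2) ∧ η m ≤ ε :=
    (hη.eventually (ge_mem_nhds (by positivity))).and (hη.eventually (ge_mem_nhds hε))
  obtain ⟨M, hM⟩ := eventually_atTop.1 hev
  have hiter (n : ℕ) (b : β) : u b (M + n * K) ≤ ε / 2 + (1 - c) ^ n * max C 0 := by
    induction n with
    | zero =>
      simp only [zero_mul, add_zero, pow_zero, one_mul]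
      linarith [hC b M, le_max_left C 0]
    | succ n ih =>
      rw [show M + (n + 1) * K = M + n * K + K by ring]
      refine (hstep b _).trans ?_
      have h1 := mul_le_mul_of_nonneg_left ih (sub_nonneg.2 hc1)
      have h2 := (hM (M + n * K) (by omega)).1
      calc _ ≤ (1 - c) * (ε / 2 + (1 - c) ^ n * max C 0) + c * (ε / 2) := add_le_add h1 h2
        _ = _ := by ring
  have hlim : Tendsto (fun n : ℕ => (1 - c) ^ n * max C 0) atTop (𝓝 0) := by
    simpa using (tendsto_pow_atTop_nhds_zero_of_lt_one (sub_nonneg.2 hc1)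
      (by linarith : 1 - c < 1)).mul_const (max C 0)
  obtain ⟨n, hn⟩ := (hlim.eventually (ge_mem_nhds (half_pos hε))).exists
  exact ⟨M + n * K, (hM _ (by omega)).2, fun b => (hiter n b).trans (by linarith)⟩

/-- The copies of `x'` have a density that is approximated by the densities in the patches
`S_b^m(Q)`, uniformly in `b`. -/
theorem IsSubstSystem.exists_density_limit [Finite J] [Nonempty J] (h : IsSubstSystem X S lam)
    {l : ℕ} {D : Fin l → Set (Euc d)} (hD : IsPrototileSystem X D)
    (hprim : ∀ b, IsPrimitiveSeq D S b) (hx' : x' ∈ patches X) {P₀ : Set (Euc d)}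
    (hP₀ : P₀ ∈ x') {η : ℕ → ℝ} (hηlim : Tendsto η atTop (𝓝 0))
    (hη : ∀ b m, ∀ p ∈ patches X, ∀ Q ∈ p, ((crossings S b m x' p P₀ Q).ncard : ℝ) ≤
      η m * (scale lam b m ^ d * volume.real Q)) :
    ∃ f : (ℕ → J) → ℝ, ∃ C : ℝ, (∀ b, f b ≤ C) ∧
      (∀ b m, (∀ Q ∈ tiles X, 0 < density S lam x' b m Q) → 0 < f b) ∧
      ∀ ε > 0, ∃ m, ∀ b, ∃ A B : ℝ, 0 ≤ A ∧ A ≤ f b ∧ f b - ε ≤ A ∧ B ≤ f b + ε ∧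
        ∀ Q ∈ tiles X, A ≤ density S lam x' b m Q ∧ density S lam x' b m Q + η m ≤ B := by
  have hX := h.isTilingSpace
  have hfr (P : Set (Euc d)) (hP : P ∈ tiles X) := h.volume_frontier hD hprim hP
  obtain ⟨v, hv, w, hw, hvw⟩ := exists_forall_volume_bounds hX hD
  obtain ⟨μ, ν, hμ, hν, hsc⟩ := h.exists_scale_bounds
  obtain ⟨N, hN⟩ := h.exists_forall_vadd_mem hD hprim
  have : Nonempty (Fin l) := by
    obtain ⟨i, -⟩ := hD.exists_eq _ (subset_tiles_of_mem_patches hx' hP₀)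
    exact ⟨i⟩
  let lo : (ℕ → J) → ℕ → ℝ := fun b m => ⨅ i, density S lam x' b m (D i)
  let hi : (ℕ → J) → ℕ → ℝ := fun b m => ⨆ i, density S lam x' b m (D i)
  have hlo (b : ℕ → J) (m : ℕ) : ∀ Q ∈ tiles X, lo b m ≤ density S lam x' b m Q := by
    intro Q hQ
    obtain ⟨i, t, rfl⟩ := hD.exists_eq Q hQ
    rw [h.density_vadd b m (hD.mem i)]
    exact ciInf_le (Set.finite_range _).bddBelow i
  have hhi (b : ℕ → J) (m : ℕ) : ∀ Q ∈ tiles X, density S lam x' b m Q ≤ hi b m := by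
    intro Q hQ
    obtain ⟨i, t, rfl⟩ := hD.exists_eq Q hQ
    rw [h.density_vadd b m (hD.mem i)]
    exact le_ciSup (f := fun i => density S lam x' b m (D i)) (Set.finite_range _).bddAbove i
  have hlo_ge {b : ℕ → J} {m : ℕ} {A : ℝ} (hA : ∀ Q ∈ tiles X, A ≤ density S lam x' b m Q) :
      A ≤ lo b m := le_ciInf fun i => hA _ (hD.mem i)
  have hhi_le {b : ℕ → J} {m : ℕ} {B : ℝ} (hB : ∀ Q ∈ tiles X, density S lam x' b m Q ≤ B) :
      hi b m ≤ B := ciSup_le fun i => hB _ (hD.mem i)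
  have hlohi (b : ℕ → J) (m : ℕ) : lo b m ≤ hi b m :=
    (hlo b m _ (hD.mem (Classical.arbitrary _))).trans (hhi b m _ (hD.mem _))
  have hlo0 (b : ℕ → J) (m : ℕ) : 0 ≤ lo b m := hlo_ge fun Q _ => h.density_nonneg b m Q
  have hhiC (b : ℕ → J) (m : ℕ) : hi b m ≤ 1 / v :=
    hhi_le fun Q hQ => h.density_le hfr hv (fun P hP => (hvw P hP).1) hx' b m hQ
  have hlomono (b : ℕ → J) (m k : ℕ) : lo b m ≤ lo b (m + k) :=
    hlo_ge fun P hP => h.le_density_add hfr hx' hP (hlo b m) k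
  have hhimono (b : ℕ → J) (m k : ℕ) : hi b (m + k) ≤ hi b m + η m :=
    hhi_le fun P hP => h.density_add_le hfr hx' hP hP₀ (hη b m) (hhi b m) k
  have hbdd (b : ℕ → J) : BddAbove (Set.range (lo b)) :=
    ⟨1 / v, by rintro _ ⟨m, rfl⟩; exact (hlohi b m).trans (hhiC b m)⟩
  set K := N + 1
  -- A lower bound for the volume share of any prototile in any supertile of level `K`; the cap
  -- keeps `1 - c` nonnegative.
  set c := min 1 (v / ((ν ^ K) ^ d * w)) with hcdef
  have hc : 0 < c := lt_min one_pos (by positivity)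
  have hstep (b : ℕ → J) (m : ℕ) :
      hi b (m + K) - lo b (m + K) ≤ (1 - c) * (hi b m - lo b m) + η m := by
    have h1 : hi b (m + K) ≤ hi b m + η m - c * (hi b m - lo b m) := by
      refine hhi_le fun P hP => ?_
      -- The prototile of least density occurs in the level-`K` image of `P`, and its deficit is the
      -- whole gap `hi b m - lo b m`.
      obtain ⟨i, hi₀⟩ := exists_eq_ciInf_of_finite (f := fun i => density S lam x' b m (D i))
      obtain ⟨t, ht⟩ := hN K (Nat.le_succ N) (tail b m) P hP (D i) (hD.mem i)
      have key := h.density_add_mul_le hfr hx' hP hP₀ (hη b m) (hhi b m) ht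
      rw [h.density_vadd b m (hD.mem i), volume_real_vadd, hi₀] at key
      change _ ≤ _ - (hi b m - lo b m) * _ at key
      have hvolP := (hX.isTile hP).volume_real_pos
      have hs := pow_pos (h.scale_pos (tail b m) K) d
      have hcle : c * (scale lam (tail b m) K ^ d * volume.real P) ≤ volume.real (D i) := by
        have hle : scale lam (tail b m) K ^ d * volume.real P ≤ (ν ^ K) ^ d * w :=
          mul_le_mul (pow_le_pow_left₀ (h.scale_pos _ _).le (hsc _ _).2 d) (hvw P hP).2
            hvolP.le (by positivity)
        calc _ ≤ v / ((ν ^ K) ^ d * w) * ((ν ^ K) ^ d * w) :=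
              mul_le_mul (min_le_right _ _) hle (by positivity) (by positivity)
          _ = v := div_mul_cancel₀ _ (by positivity)
          _ ≤ _ := (hvw _ (hD.mem i)).1
      have := mul_le_mul_of_nonneg_left hcle (sub_nonneg.2 (hlohi b m))
      refine le_of_mul_le_mul_right (key.trans ?_) (mul_pos hs hvolP)
      linarith
    linarith [hlomono b m K]
  refine ⟨fun b => ⨆ m, lo b m, 1 / v, fun b => ciSup_le fun m => (hlohi b m).trans (hhiC b m),
    fun b m hpos => ?_, fun ε hε => ?_⟩
  · obtain ⟨i, hi₀⟩ := exists_eq_ciInf_of_finite (f := fun i => density S lam x' b m (D i))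
    have : 0 < lo b m := by
      change 0 < ⨅ i, density S lam x' b m (D i)
      rw [← hi₀]
      exact hpos _ (hD.mem i)
    exact this.trans_le (le_ciSup (hbdd b) m)
  · obtain ⟨m, hm1, hm2⟩ := exists_uniform_small (u := fun b m => hi b m - lo b m)
      hc (min_le_left _ _) (fun b m => (sub_le_self _ (hlo0 b m)).trans (hhiC b m)) hηlim hstep
      (half_pos hε)
    refine ⟨m, fun b => ⟨lo b m, hi b m + η m, hlo0 b m, le_ciSup (hbdd b) m, ?_, ?_,
      fun Q hQ => ⟨hlo b m Q hQ, add_le_add_left (hhi b m Q hQ) _⟩⟩⟩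
    -- Moving to the common level `m + n` compares the least density at any level with the greatest
    -- density at level `m`.
    · have : ⨆ n, lo b n ≤ hi b m + η m := ciSup_le fun n => by
        calc lo b n ≤ lo b (n + m) := hlomono b n m
          _ = lo b (m + n) := by rw [add_comm]
          _ ≤ hi b (m + n) := hlohi b _
          _ ≤ _ := hhimono b m n
      have := hm2 b
      linarith
    · have h1 := le_ciSup (hbdd b) m
      have h2 := hm2 b
      simp only at h2 ⊢
      linarith

end

section

variable {d : ℕ} {J : Type*} {S : J → Set (Euc d) → Coll d} {X : Set (Coll d)} {lam : J → ℝ}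
  {x' : Coll d}

/-! ### Counting copies in windows of a limit tiling -/

/-- Large finite parts of the limit tiling split into supertiles of the prescribed level `m`, since
their level is at least `m`. -/
theorem IsSubstSystem.exists_large_desubstitution [Finite J] [Nonempty J]
    (h : IsSubstSystem X S lam) {D₀ : Set (Euc d)} (hD₀ : D₀ ∈ tiles X) {b : ℕ → J} {y : Coll d}
    (hy : IsLimitTiling S D₀ b y) {F : Coll d} (hF : F.Finite) (hFy : F ⊆ y) (R : ℝ) (m : ℕ) :
    ∃ p ∈ patches X, F ⊆ iterSubst S b m p ∧ iterSubst S b m p ⊆ y ∧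
      Metric.closedBall 0 R ⊆ supp (iterSubst S b m p) := by
  obtain ⟨k, hk, t, h1⟩ := h.exists_large_patch hD₀ hy hF hFy R m
  obtain ⟨j, rfl⟩ := Nat.exists_eq_add_of_le hk
  have hp := h.iterSubst_mem_patches (tail b m) j (singleton_mem_patches hD₀)
  refine ⟨_, h.isTilingSpace.vadd_mem_patches hp ((scale lam b m)⁻¹ • t), ?_⟩
  rwa [h.iterSubst_vadd b m (subset_tiles_of_mem_patches hp), smul_inv_smul₀ (h.scale_pos b m).ne',
    ← iterSubst_add]

/-- The translations that move `x'` into the part of `y` that lies in `H`. -/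
def copiesIn (x' y : Coll d) (H : Set (Euc d)) : Set (Euc d) :=
  {t | t +ᵥ x' ⊆ y ∧ supp (t +ᵥ x') ⊆ H}

theorem ncard_copiesIn (hX : IsTilingSpace X) (hx' : x' ∈ patches X) (y : Coll d)
    (H : Set (Euc d)) :
    {q : Coll d | (∃ t : Euc d, q = t +ᵥ x') ∧ q ⊆ y ∧ supp q ⊆ H}.ncard =
      (copiesIn x' y H).ncard := by
  have hinj : Function.Injective fun t : Euc d => t +ᵥ x' := by
    intro t s hts
    have := congrArg supp hts
    simp only [supp_vadd] at this
    exact vadd_set_injective (isCompact_supp hX hx') (supp_nonempty hX hx') this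
  rw [← Set.ncard_image_of_injective _ hinj]
  congr 1
  ext q
  constructor
  · rintro ⟨⟨t, rfl⟩, h1, h2⟩
    exact ⟨t, ⟨h1, h2⟩, rfl⟩
  · rintro ⟨t, ⟨h1, h2⟩, rfl⟩
    exact ⟨⟨t, rfl⟩, h1, h2⟩

theorem finite_copiesIn (hX : IsTilingSpace X) (hfr : ∀ P ∈ tiles X, volume (frontier P) = 0)
    {v : ℝ} (hv : 0 < v) (hvol : ∀ P ∈ tiles X, v ≤ volume.real P) (hx' : x' ∈ patches X)
    {y : Coll d} (hy : y ∈ X) {H : Set (Euc d)} (hH : volume H < ⊤) :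
    (copiesIn x' y H).Finite := by
  obtain ⟨P₀, hP₀⟩ := hx'.2.1
  have hP₀t := hX.isTile (subset_tiles_of_mem_patches hx' hP₀)
  have himg : (fun t : Euc d => t +ᵥ P₀) '' copiesIn x' y H ⊆ y := by
    rintro _ ⟨t, ht, rfl⟩
    exact ht.1 (Set.vadd_mem_vadd_set hP₀)
  refine Set.Finite.of_finite_image ?_ hP₀t.vadd_injective.injOn
  refine ((hX.isPatch_of_subset hy himg).finite_and_ncard_mul_le
    (fun P hP => hfr P ⟨y, hy, himg hP⟩) hv (fun P hP => hvol P ⟨y, hy, himg hP⟩) hH ?_).1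
  rintro _ ⟨t, ht, rfl⟩
  exact (subset_supp (Set.vadd_mem_vadd_set hP₀)).trans ht.2

section Window

variable [Finite J] [Nonempty J] (h : IsSubstSystem X S lam)
  (hfr : ∀ P ∈ tiles X, volume (frontier P) = 0) {R : ℝ}
  (hR : ∀ P ∈ tiles X, ∀ z ∈ P, ∀ w ∈ P, dist z w ≤ R) (hx' : x' ∈ patches X)
  {D₀ : Set (Euc d)} (hD₀ : D₀ ∈ tiles X) {b : ℕ → J} {y : Coll d} (hy : IsLimitTiling S D₀ b y)
  {m : ℕ} {r : ℝ} (hr : scale lam b m * R ≤ r) {H : Set (Euc d)} (hH : volume H < ⊤)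
  (hN : volume (Metric.cthickening r (frontier H)) < ⊤) (hfin : (copiesIn x' y H).Finite)
include h hfr hR hx' hD₀ hy hr hH hN hfin

omit [Finite J] [Nonempty J] hfr hx' hD₀ hy hH hN hfin in
theorem IsSubstSystem.dist_le_of_mem_smul {P : Set (Euc d)} (hP : P ∈ tiles X) {z w : Euc d}
    (hz : z ∈ scale lam b m • P) (hw : w ∈ scale lam b m • P) : dist z w ≤ r := by
  obtain ⟨z, hz, rfl⟩ := hz
  obtain ⟨w, hw, rfl⟩ := hw
  rw [dist_smul₀, Real.norm_of_nonneg (h.scale_pos _ _).le]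
  exact (mul_le_mul_of_nonneg_left (hR P hP z hz w hw) (h.scale_pos _ _).le).trans hr

omit [Finite J] [Nonempty J] hR hx' hD₀ hy hr hH hN hfin in
theorem IsSubstSystem.mul_sum_volume_eq {p : Coll d} (hp : p ∈ patches X)
    {F : Finset (Set (Euc d))} (hF : (F : Coll d) ⊆ p) :
    scale lam b m ^ d * ∑ Q ∈ F, volume.real Q = volume.real (⋃ Q ∈ F, scale lam b m • Q) := by
  rw [← volume_real_biUnion_of_frontier ((h.isTilingSpace.isPatch hp).mono hF)
    fun Q hQ => hfr Q (subset_tiles_of_mem_patches hp (hF hQ)),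
    ← volume_real_smul (h.scale_pos b m), Set.smul_set_iUnion₂]

theorem IsSubstSystem.ncard_copiesIn_le {P₀ : Set (Euc d)} (hP₀ : P₀ ∈ x') {η : ℝ}
    (hη : ∀ p ∈ patches X, ∀ Q ∈ p, ((crossings S b m x' p P₀ Q).ncard : ℝ) ≤
      η * (scale lam b m ^ d * volume.real Q)) {B : ℝ} (hB0 : 0 ≤ B)
    (hB : ∀ Q ∈ tiles X, density S lam x' b m Q + η ≤ B) :
    ((copiesIn x' y H).ncard : ℝ) ≤
      B * (volume.real H + volume.real (Metric.cthickening r (frontier H))) := by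
  classical
  -- Only finitely many copies lie in `H`, so a single finite patch of supertiles contains them all.
  set F₀ : Coll d := ⋃ t ∈ copiesIn x' y H, t +ᵥ x'
  have hF₀ : F₀.Finite := hfin.biUnion fun t _ => hx'.1.vadd_set
  obtain ⟨p, hp, hF₀p, hpy, -⟩ := h.exists_large_desubstitution hD₀ hy hF₀
    (Set.iUnion₂_subset fun t ht => ht.1) 0 m
  have hpt := subset_tiles_of_mem_patches hp
  have hmem {Q : Set (Euc d)} : Q ∈ hp.1.toFinset.filter
      (fun Q => (scale lam b m • Q ∩ H).Nonempty) ↔ Q ∈ p ∧ (scale lam b m • Q ∩ H).Nonempty := by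
    simp
  set F := hp.1.toFinset.filter (fun Q => (scale lam b m • Q ∩ H).Nonempty)
  have hFp : (F : Coll d) ⊆ p := fun Q hQ => (hmem.1 hQ).1
  have key := h.ncard_le_sum_density hx' hp hP₀ (hη p hp) hFp (T := copiesIn x' y H)
    (fun t ht => (Set.subset_biUnion_of_mem (u := fun t => t +ᵥ x') ht).trans hF₀p)
    (fun t ht Q hQ htQ => by
      refine hmem.2 ⟨hQ, ?_⟩
      obtain ⟨z, hz⟩ := (h.isTilingSpace.isTile
        (h.mem_tiles_of_mem (Set.singleton_subset_iff.2 (hpt hQ)) htQ)).nonempty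
      exact ⟨z, h.subset_smul_of_mem (hpt hQ) htQ hz,
        ht.2 (subset_supp (Set.vadd_mem_vadd_set hP₀) hz)⟩)
  have hsum : ∑ Q ∈ F, (density S lam x' b m Q + η) * (scale lam b m ^ d * volume.real Q) ≤
      B * volume.real (⋃ Q ∈ F, scale lam b m • Q) := by
    rw [← h.mul_sum_volume_eq hfr hp hFp, Finset.mul_sum, Finset.mul_sum]
    refine Finset.sum_le_sum fun Q hQ => mul_le_mul_of_nonneg_right (hB Q (hpt (hFp hQ)))
      (mul_nonneg (pow_nonneg (h.scale_pos b m).le d) measureReal_nonneg)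
  refine (key.trans hsum).trans (mul_le_mul_of_nonneg_left ?_ hB0)
  refine le_trans (measureReal_mono (Set.iUnion₂_subset fun Q hQ z hz => ?_)
    (measure_union_lt_top hH hN).ne) (measureReal_union_le _ _)
  by_cases hzH : z ∈ H
  · exact Or.inl hzH
  · obtain ⟨hQp, w, hw, hwH⟩ := hmem.1 hQ
    exact Or.inr (mem_cthickening_frontier hwH hzH
      (h.dist_le_of_mem_smul hR hr (hpt hQp) hw hz)).2

theorem IsSubstSystem.le_ncard_copiesIn {A : ℝ} (hA0 : 0 ≤ A)
    (hA : ∀ Q ∈ tiles X, A ≤ density S lam x' b m Q) :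
    A * (volume.real H - volume.real (Metric.cthickening r (frontier H))) ≤
      (copiesIn x' y H).ncard := by
  classical
  -- `H` may be unbounded whereas patches are finite, so volumes are first cut off by a ball, which
  -- then grows.
  have hwindow (n : ℕ) : A * (volume.real (H ∩ Metric.closedBall 0 n) -
      volume.real (Metric.cthickening r (frontier H))) ≤ (copiesIn x' y H).ncard := by
    obtain ⟨p, hp, -, hpy, hball⟩ := h.exists_large_desubstitution hD₀ hy Set.finite_empty
      (Set.empty_subset _) n m
    have hpt := subset_tiles_of_mem_patches hp
    have hmem {Q : Set (Euc d)} : Q ∈ hp.1.toFinset.filter (fun Q => scale lam b m • Q ⊆ H) ↔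
        Q ∈ p ∧ scale lam b m • Q ⊆ H := by simp
    set F := hp.1.toFinset.filter (fun Q => scale lam b m • Q ⊆ H)
    have hFp : (F : Coll d) ⊆ p := fun Q hQ => (hmem.1 hQ).1
    have key := h.mul_sum_volume_le hx' hp b m hFp hfin
      (fun Q hQ t ht => ⟨ht.trans ((iterSubst_mono S b m
        (Set.singleton_subset_iff.2 (hFp hQ))).trans hpy), (supp_mono ht).trans <| by
          rw [h.supp_iterSubst_singleton b m (hpt (hFp hQ))]
          exact (hmem.1 hQ).2⟩)
      (fun Q hQ => hA Q (hpt (hFp hQ)))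
    refine le_trans (mul_le_mul_of_nonneg_left ?_ hA0) key
    rw [h.mul_sum_volume_eq hfr hp hFp, sub_le_iff_le_add]
    have hFH : ⋃ Q ∈ F, scale lam b m • Q ⊆ H := Set.iUnion₂_subset fun Q hQ => (hmem.1 hQ).2
    refine le_trans (measureReal_mono ?_
      (measure_union_lt_top ((measure_mono hFH).trans_lt hH) hN).ne) (measureReal_union_le _ _)
    rintro z ⟨hzH, hzn⟩
    have hz := hball hzn
    rw [h.supp_iterSubst b m hpt] at hz
    obtain ⟨z, ⟨Q, hQ, hzQ⟩, rfl⟩ := hz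
    by_cases hQH : scale lam b m • Q ⊆ H
    · exact Or.inl (Set.mem_biUnion (hmem.2 ⟨hQ, hQH⟩) (Set.smul_mem_smul_set hzQ))
    · obtain ⟨w, hw, hwH⟩ := Set.not_subset.1 hQH
      exact Or.inr (mem_cthickening_frontier hzH hwH
        (h.dist_le_of_mem_smul hR hr (hpt hQ) (Set.smul_mem_smul_set hzQ) hw)).1
  have hlim : Tendsto (fun n : ℕ => volume.real (H ∩ Metric.closedBall 0 (n : ℝ))) atTop
      (𝓝 (volume.real H)) := by
    have hmono : Monotone fun n : ℕ => H ∩ Metric.closedBall 0 (n : ℝ) := fun i j hij =>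
      Set.inter_subset_inter_right _ (Metric.closedBall_subset_closedBall (Nat.cast_le.2 hij))
    have := tendsto_measure_iUnion_atTop (μ := volume) hmono
    rw [← Set.inter_iUnion, Metric.iUnion_closedBall_nat, Set.inter_univ] at this
    exact (ENNReal.tendsto_toReal hH.ne).comp this
  exact le_of_tendsto ((hlim.sub_const _).const_mul A) (Eventually.of_forall hwindow)

end Window

end

section

variable {d : ℕ} {J : Type*} {S : J → Set (Euc d) → Coll d} {X : Set (Coll d)} {lam : J → ℝ}
  {x' : Coll d}

/-! ### Frequencies -/

theorem IsSubstSystem.density_pos (h : IsSubstSystem X S lam) (hx' : x' ∈ patches X) {b : ℕ → J}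
    {m : ℕ} {Q : Set (Euc d)} (hQ : Q ∈ tiles X)
    (hne : (copies x' (iterSubst S b m {Q})).Nonempty) : 0 < density S lam x' b m Q := by
  have hfin := h.isTilingSpace.finite_copies hx'
    (h.iterSubst_mem_patches b m (singleton_mem_patches hQ)).1
  exact div_pos (Nat.cast_pos.2 ((Set.ncard_pos hfin).2 hne))
    (mul_pos (pow_pos (h.scale_pos b m) d) (h.isTilingSpace.isTile hQ).volume_real_pos)

theorem eq_of_seqDist_lt {a b : ℕ → J} {k : ℕ} (h : seqDist a b < 1 / ((k : ℝ) + 1)) :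
    ∀ i < k, a i = b i := by
  intro i hi
  by_cases hab : a = b
  · rw [hab]
  rw [seqDist, if_neg hab, one_div_lt_one_div (by positivity) (by positivity),
    add_lt_add_iff_right, Nat.cast_lt] at h
  exact PiNat.apply_eq_of_lt_firstDiff (hi.trans h)

theorem mem_patches_multiSubstSpace [Finite J] [Nonempty J] (h : IsSubstSystem X S lam)
    (hcomplete : IsCompleteTilingSpace X) {D₀ : Set (Euc d)} (hD₀ : D₀ ∈ tiles X)
    (hx' : x' ∈ patches X) {b : ℕ → J} {y : Coll d} (hy : IsLimitTiling S D₀ b y) {m : ℕ}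
    (hm : ∀ Q ∈ tiles X, (copies x' (iterSubst S b m {Q})).Nonempty) :
    x' ∈ patches (multiSubstSpace X S D₀ b) := by
  have hyX := h.limitTiling_mem hcomplete hD₀ hy
  obtain ⟨p, hp, -, hpy, -⟩ := h.exists_large_desubstitution hD₀ hy Set.finite_empty
    (Set.empty_subset _) 0 m
  obtain ⟨Q, hQ⟩ := hp.2.1
  obtain ⟨t, ht⟩ := hm Q (subset_tiles_of_mem_patches hp hQ)
  have hty : t +ᵥ x' ⊆ y :=
    Set.Subset.trans ht ((iterSubst_mono S b m (Set.singleton_subset_iff.2 hQ)).trans hpy)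
  refine ⟨hx'.1, hx'.2.1, -t +ᵥ y, ⟨h.isTilingSpace.vadd_mem _ _ hyX, fun q hq hfin => ?_⟩, ?_⟩
  · have hqy : t +ᵥ q ⊆ y := by
      rw [Set.vadd_set_subset_iff_subset_neg_vadd_set]; exact hq
    -- A level of at least 2 avoids the exceptional value of `levelPatch` at level 1.
    obtain ⟨k, hk, s, hs, -, -⟩ := h.exists_large_patch hD₀ hy hfin.vadd_set hqy 0 2
    refine ⟨k, by omega, -s + t, ?_⟩
    rw [levelPatch, if_neg (by omega), add_vadd, Set.vadd_set_subset_iff_subset_neg_vadd_set,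
      neg_neg]
    exact hs
  · rwa [← Set.vadd_set_subset_iff_subset_neg_vadd_set]

/-- If `L` lies between `A (V - N)` and `B (V + N)`, where `A` and `B` are close to `f` and `N`
is small compared to `V`, then `L / V` is close to `f`. -/
theorem abs_div_sub_le {A B C f ε L V N : ℝ} (hAf : A ≤ f) (hfC : f ≤ C)
    (hA : f - ε ≤ A) (hB : B ≤ f + ε) (hε : 0 ≤ ε) (hV : 0 < V) (hN : 0 ≤ N)
    (hlow : A * (V - N) ≤ L) (hupp : L ≤ B * (V + N)) :
    |L / V - f| ≤ ε + (C + ε) * (N / V) := by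
  have he : 0 ≤ N / V := div_nonneg hN hV.le
  have h1 : A * (1 - N / V) ≤ L / V := by
    rw [le_div_iff₀ hV, mul_assoc, sub_mul, one_mul, div_mul_cancel₀ _ hV.ne']
    exact hlow
  have h2 : L / V ≤ B * (1 + N / V) := by
    rw [div_le_iff₀ hV, mul_assoc, add_mul, one_mul, div_mul_cancel₀ _ hV.ne']
    exact hupp
  have h3 : A * (N / V) ≤ C * (N / V) := mul_le_mul_of_nonneg_right (hAf.trans hfC) he
  have h4 : B * (1 + N / V) ≤ (f + ε) * (1 + N / V) :=
    mul_le_mul_of_nonneg_right hB (by linarith)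
  have h5 : f * (N / V) ≤ C * (N / V) := mul_le_mul_of_nonneg_right hfC he
  have h6 : 0 ≤ ε * (N / V) := mul_nonneg hε he
  rw [abs_le]
  constructor <;> linarith

/-- Both the level `m` and the collar width are chosen before `b`, so the threshold on `n` works for
all sequences at once. Positivity of `f b` is kept as a separate conclusion because it needs `x'` to
occur. -/
theorem IsSubstSystem.exists_uniform_frequency [Finite J] [Nonempty J]
    (h : IsSubstSystem X S lam) (hcomplete : IsCompleteTilingSpace X) {l : ℕ}
    {D : Fin l → Set (Euc d)} (hD : IsPrototileSystem X D) (hprim : ∀ b, IsPrimitiveSeq D S b)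
    {D₀ : Set (Euc d)} (hD₀ : D₀ ∈ tiles X) (hx' : x' ∈ patches X) :
    ∃ f : (ℕ → J) → ℝ,
      (∀ b m, (∀ Q ∈ tiles X, 0 < density S lam x' b m Q) → 0 < f b) ∧
      ∀ H : ℕ → Set (Euc d), IsVanHove H → ∀ ε > 0, ∀ᶠ n in atTop, ∀ b,
        |(patchCount S D₀ b x' (H n) : ℝ) / (volume (H n)).toReal - f b| < ε := by
  have hX := h.isTilingSpace
  have hfr (P : Set (Euc d)) (hP : P ∈ tiles X) := h.volume_frontier hD hprim hP
  obtain ⟨v, hv, w, hw, hvw⟩ := exists_forall_volume_bounds hX hD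
  obtain ⟨μ, ν, hμ, hν, hsc⟩ := h.exists_scale_bounds
  obtain ⟨R, hR, hdiam⟩ := exists_forall_dist_le hX hD
  obtain ⟨P₀, hP₀⟩ := hx'.2.1
  obtain ⟨η, hη0, hηlim, hη⟩ := h.exists_crossings_bound hD hprim hx' hP₀
  obtain ⟨f, C, hfC, hfpos, hf⟩ := h.exists_density_limit hD hprim hx' hP₀ hηlim hη
  refine ⟨f, hfpos, fun H hH ε hε => ?_⟩
  obtain ⟨m, hm⟩ := hf (ε / 2) (half_pos hε)
  -- A bound for the diameters of level-`m` supertiles valid for every `b`.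
  set r := ν ^ m * R with hrdef
  have hr : 0 ≤ r := by positivity
  have hlim := hH.tendsto r hr
  have hlim' : Tendsto (fun n => ε / 2 + (C + ε / 2) *
      (volume.real (Metric.cthickening r (frontier (H n))) / volume.real (H n))) atTop
      (𝓝 (ε / 2 + (C + ε / 2) * 0)) := by
    refine ((Tendsto.const_mul _ ?_).const_add _)
    have := (ENNReal.tendsto_toReal ENNReal.zero_ne_top).comp hlim
    simpa only [Function.comp_def, ENNReal.toReal_div, ENNReal.toReal_zero, Measure.real] using this
  rw [mul_zero, add_zero] at hlim'
  -- The ratio below 1 in `[0, ∞]` ensures that the collar has finite volume, so real volumes are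
  -- meaningful.
  filter_upwards [hlim.eventually (gt_mem_nhds (zero_lt_one (α := ENNReal))),
    hlim'.eventually (gt_mem_nhds (half_lt_self hε))] with n hn1 hn2 b
  have hHn := hH.volume_lt_top n
  have hVpos : 0 < volume.real (H n) := ENNReal.toReal_pos (hH.volume_pos n).ne' hHn.ne
  have hNn : volume (Metric.cthickening r (frontier (H n))) < ⊤ := by
    by_contra htop
    rw [not_lt_top_iff.1 htop, ENNReal.top_div_of_ne_top hHn.ne] at hn1
    exact not_top_lt hn1
  have hlimit : IsLimitTiling S D₀ b (limitTiling S D₀ b) :=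
    Classical.epsilon_spec (h.exists_isLimitTiling hD hprim hD₀ b)
  obtain ⟨A, B, hA0, hAf, hA, hB, hAB⟩ := hm b
  have hfin := finite_copiesIn hX hfr hv (fun P hP => (hvw P hP).1) hx'
    (h.limitTiling_mem hcomplete hD₀ hlimit) hHn
  have hrb : scale lam b m * R ≤ r := mul_le_mul_of_nonneg_right (hsc b m).2 hR.le
  have hB0 : 0 ≤ B := (add_nonneg (h.density_nonneg b m D₀) (hη0 m)).trans (hAB D₀ hD₀).2
  have hupp := h.ncard_copiesIn_le hfr hdiam hx' hD₀ hlimit hrb hHn hNn hfin hP₀ (hη b m) hB0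
    fun Q hQ => (hAB Q hQ).2
  have hlow := h.le_ncard_copiesIn hfr hdiam hx' hD₀ hlimit hrb hHn hNn hfin hA0
    fun Q hQ => (hAB Q hQ).1
  rw [patchCount, ncard_copiesIn hX hx']
  exact (abs_div_sub_le hAf (hfC b) hA hB (half_pos hε).le hVpos measureReal_nonneg
    hlow hupp).trans_lt hn2

end

end MultiTiling

/-! ### Proof of the theorem -/

open MultiTiling in
theorem mainTheorem2 {d : ℕ} (X : Set (MultiTiling.Coll d))
    (hX : MultiTiling.IsTilingSpace X)
    (hcomplete : MultiTiling.IsCompleteTilingSpace X)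
    (hflc : MultiTiling.FiniteLocalComplexity X)
    {l : ℕ} (D : Fin l → Set (MultiTiling.Euc d))
    (hD : MultiTiling.IsPrototileSystem X D)
    {J : Type*} [Finite J] (S : J → Set (MultiTiling.Euc d) → MultiTiling.Coll d)
    (hS : ∀ j, MultiTiling.IsSubstitution X (S j))
    (hprim : ∀ b : ℕ → J, MultiTiling.IsPrimitiveSeq D S b)
    (D₀ : Set (MultiTiling.Euc d)) (hD₀ : D₀ ∈ MultiTiling.tiles X)
    (a : ℕ → J) (x' : MultiTiling.Coll d)
    (hx' : x' ∈ MultiTiling.patches (MultiTiling.multiSubstSpace X S D₀ a)) :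
    ∃ δ > 0,
      (∀ b : ℕ → J, MultiTiling.seqDist a b < δ →
        x' ∈ MultiTiling.patches (MultiTiling.multiSubstSpace X S D₀ b) ∧
        MultiTiling.IsLimitTiling S D₀ b (MultiTiling.limitTiling S D₀ b) ∧
        MultiTiling.IsPatchFreq S D₀ b x' (MultiTiling.patchFreq S D₀ b x')) ∧
      ∀ H : ℕ → Set (MultiTiling.Euc d), MultiTiling.IsVanHove H →
        TendstoUniformlyOn
          (fun n b => (MultiTiling.patchCount S D₀ b x' (H n) : ℝ) / (volume (H n)).toReal)
          (fun b => MultiTiling.patchFreq S D₀ b x') atTop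
          {b | MultiTiling.seqDist a b < δ} := by
  have : Nonempty J := ⟨a 0⟩
  choose lam hlam using fun j => (hS j).2.1
  have h : IsSubstSystem X S lam := ⟨hX, fun j => (hlam j).1, fun j => (hlam j).2.1,
    fun j => (hlam j).2.2, fun j => (hS j).2.2.1⟩
  have hx'X : x' ∈ patches X := by
    obtain ⟨h1, h2, x, hx, h3⟩ := hx'
    exact ⟨h1, h2, x, hx.1, h3⟩
  obtain ⟨k, t, hkt⟩ : ∃ k, ∃ t : Euc d, t +ᵥ x' ⊆ iterSubst S a k {D₀} := by
    obtain ⟨h1, -, x, hx, h3⟩ := hx'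
    obtain ⟨k, -, t, ht⟩ := hx.2 x' h3 h1
    by_cases hk : k = 1
    -- The level-1 patch is `D₀` itself, which is the zeroth iterate.
    · exact ⟨0, t, by simpa [levelPatch, hk] using ht⟩
    · exact ⟨k, t, by simpa only [levelPatch, if_neg hk] using ht⟩
  obtain ⟨N, hN⟩ := h.exists_forall_vadd_mem hD hprim
  obtain ⟨f, hfpos, hf⟩ := h.exists_uniform_frequency hcomplete hD hprim hD₀ hx'X
  have hcopy {b : ℕ → J} (hb : seqDist a b < 1 / ((k : ℝ) + 1)) :
      ∀ Q ∈ tiles X, (copies x' (iterSubst S b (k + N) {Q})).Nonempty := by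
    intro Q hQ
    -- The last `N` letters turn `Q` into a patch containing a translate of `D₀`; the first `k`
    -- letters, shared with `a`, turn that into a patch containing `x'` up to translation.
    obtain ⟨s, hs⟩ := hN N le_rfl (tail b k) Q hQ D₀ hD₀
    refine ⟨scale lam b k • s + t, ?_⟩
    change (scale lam b k • s + t) +ᵥ x' ⊆ _
    rw [iterSubst_add, add_vadd]
    refine Set.Subset.trans ?_ (iterSubst_mono S b k (Set.singleton_subset_iff.2 hs))
    rw [h.iterSubst_singleton_vadd b k hD₀, ← iterSubst_congr S (eq_of_seqDist_lt hb)]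
    exact Set.vadd_set_mono hkt
  have hlimit (b : ℕ → J) : IsLimitTiling S D₀ b (limitTiling S D₀ b) :=
    Classical.epsilon_spec (h.exists_isLimitTiling hD hprim hD₀ b)
  have htend {H : ℕ → Set (Euc d)} (hH : IsVanHove H) (b : ℕ → J) :
      Tendsto (fun n => (patchCount S D₀ b x' (H n) : ℝ) / (volume (H n)).toReal) atTop
        (𝓝 (f b)) :=
    Metric.tendsto_nhds.2 fun ε hε => (hf H hH ε hε).mono fun n hn => hn b
  have hfreq {b : ℕ → J} (hb : seqDist a b < 1 / ((k : ℝ) + 1)) :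
      IsPatchFreq S D₀ b x' (patchFreq S D₀ b x') :=
    Classical.epsilon_spec (p := IsPatchFreq S D₀ b x') ⟨f b, hfpos b _ fun Q hQ =>
      h.density_pos hx'X hQ (hcopy hb Q hQ), fun H hH => htend hH b⟩
  refine ⟨1 / ((k : ℝ) + 1), by positivity, fun b hb => ⟨?_, hlimit b, hfreq hb⟩, fun H hH => ?_⟩
  · exact mem_patches_multiSubstSpace h hcomplete hD₀ hx'X (hlimit b) (hcopy hb)
  · refine Metric.tendstoUniformlyOn_iff.2 fun ε hε => (hf H hH ε hε).mono fun n hn b hb => ?_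
    -- The number selected by `patchFreq` equals `f b`, because both are limits along the same
    -- sequence `H`.
    rw [tendsto_nhds_unique ((hfreq hb).2 H hH) (htend hH b), dist_comm]
    exact hn b
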